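/- Consider the class of Gardner equations $$u_t+k(t)uu_x+f(t)u^2u_x+g(t)u_{xxx}=0,\qquad fg\neq 0,$$ where $k,f,g$ are smooth real functions on an open interval. A point transformation is a smooth map $\Phi\colon(t,x,u)\mapsto(\tilde t,\tilde x,\tilde u)$ with nonvanishing Jacobian determinant on a domain (nonempty connected open set) $\Omega\subseteq\mathbb R^3$. A triple consisting of two equations of the class and a point transformation whose prolongation to third-order jets maps the first equation to the second one is called an admissible transformation; the set of all of them is the equivalence groupoid of the class. Let $\hat G^\sim$ denote the family of transformations $$\tilde t=\alpha(t),\quad \tilde x=\delta_1x+\frac{\delta_1\delta_3}{\delta_2^2}\int(\delta_2k(t)-\delta_3f(t))\,dt+\delta_4,\quad \tilde u=\delta_2u+\delta_3,$$ $$\tilde k(\tilde t)=\frac{\delta_1}{\delta_2\alpha_t}\Bigl(k(t)-2\frac{\delta_3}{\delta_2}f(t)\Bigr),\quad \tilde f(\tilde t)=\frac{\delta_1}{\delta_2^2\alpha_t}f(t),\quad \tilde g(\tilde t)=\frac{\delta_1^3}{\alpha_t}g(t),$$ where $\delta_1,\dots,\delta_4$ are constants with $\delta_1\delta_2\neq0$,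 $\alpha$ is a smooth function on an open interval with $\alpha_t\neq0$, and the integral denotes any antiderivative (the generalized extended equivalence group). Then a triple of two equations of the class and a map $\Phi$ on a domain $\Omega$ is an admissible transformation if and only if it is induced by a transformation from $\hat G^\sim$: that is, for some choice of $\alpha$, $\delta_1,\dots,\delta_4$ and of the antiderivative, $\Phi$ is given on $\Omega$ by the above formulas for $\tilde t,\tilde x,\tilde u$ and the coefficients of the two equations are related by the above formulas for $\tilde k,\tilde f,\tilde g$ on an open interval containing the projection of $\Omega$ to the $t$-axis. Moreover, each transformation from $\hat G^\sim$ maps every equation of the class whose coefficients are defined on the interval of $\alpha$ to an equation of the class, and the transformations induced by $\hat G^\sim$ include the identity and are closed under composition and inversion. Thus the class is normalized in the generalized extended sense. -/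

import Mathlib

open Set Filter Topology
open scoped ContDiff

/-- An equation `u_t + k(t) u u_x + f(t) u² u_x + g(t) u_xxx = 0` with `f g ≠ 0`, whose coefficients
are smooth functions on a nonempty open interval `dom` (values outside `dom` are irrelevant). -/
structure GardnerEq where
  dom : Set ℝ
  isOpen_dom : IsOpen dom
  isConnected_dom : IsConnected dom
  k : ℝ → ℝ
  f : ℝ → ℝ
  g : ℝ → ℝ
  smooth_k : ContDiffOn ℝ ∞ k dom
  smooth_f : ContDiffOn ℝ ∞ f dom
  smooth_g : ContDiffOn ℝ ∞ g dom
  fg_ne_zero : ∀ t ∈ dom, f t * g t ≠ 0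

/-- The function `u` (of `t` and `x`) satisfies the equation `E` at the point `(t, x)`, i.e. the
third-order jet of `u` at `(t, x)` belongs to the manifold determined by `E` in the jet space. -/
def GardnerEq.HoldsAt (E : GardnerEq) (u : ℝ → ℝ → ℝ) (t x : ℝ) : Prop :=
  deriv (fun s => u s x) t + E.k t * u t x * deriv (u t) x + E.f t * u t x ^ 2 * deriv (u t) x
    + E.g t * iteratedDeriv 3 (u t) x = 0

/-- A nondegenerate point transformation `(t, x, u) ↦ Φ (t, x, u)`, defined on a domain `Ω`
(a nonempty connected open set) of the space of independent and dependent variables. -/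
structure IsPointTransformation (Ω : Set (ℝ × ℝ × ℝ)) (Φ : ℝ × ℝ × ℝ → ℝ × ℝ × ℝ) : Prop where
  isOpen : IsOpen Ω
  isConnected : IsConnected Ω
  smooth : ContDiffOn ℝ ∞ Φ Ω
  nondegenerate : ∀ p ∈ Ω, (fderiv ℝ Φ p).det ≠ 0

/-- `Φ` maps the germ at `(t, x)` of the graph of `u` into the graph of `v`. -/
def MapsGraphAt (Φ : ℝ × ℝ × ℝ → ℝ × ℝ × ℝ) (u v : ℝ → ℝ → ℝ) (t x : ℝ) : Prop :=
  ∀ᶠ q : ℝ × ℝ in 𝓝 (t, x),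
    v (Φ (q.1, q.2, u q.1 q.2)).1 (Φ (q.1, q.2, u q.1 q.2)).2.1 = (Φ (q.1, q.2, u q.1 q.2)).2.2

/-- The triple `(E, Φ, E')` is an admissible transformation: `Φ` is a nondegenerate point
transformation on `Ω` whose prolongation to third-order jets maps `E` to `E'`. The prolongation
sends the jet of `u` at `(t, x)` to the jet, at the transformed point, of the function `v` whose
graph is the image of the graph of `u` under `Φ`, whenever this image is locally a graph. -/
structure IsAdmissible (E E' : GardnerEq) (Ω : Set (ℝ × ℝ × ℝ))
    (Φ : ℝ × ℝ × ℝ → ℝ × ℝ × ℝ) : Prop where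
  isPointTransformation : IsPointTransformation Ω Φ
  source_mem : ∀ p ∈ Ω, p.1 ∈ E.dom
  target_mem : ∀ p ∈ Ω, (Φ p).1 ∈ E'.dom
  holds_iff : ∀ (t x : ℝ) (u v : ℝ → ℝ → ℝ),
    (t, x, u t x) ∈ Ω →
    ContDiffAt ℝ ∞ (fun q : ℝ × ℝ => u q.1 q.2) (t, x) →
    ContDiffAt ℝ ∞ (fun q : ℝ × ℝ => v q.1 q.2) ((Φ (t, x, u t x)).1, (Φ (t, x, u t x)).2.1) →
    MapsGraphAt Φ u v t x →
    (E.HoldsAt u t x ↔ E'.HoldsAt v (Φ (t, x, u t x)).1 (Φ (t, x, u t x)).2.1)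

/-- The parameters of a transformation from the generalized extended equivalence group of the class:
a smooth function `α` with nonvanishing derivative on a nonempty open interval `dom`, and constants
`δ₁, δ₂, δ₃, δ₄` with `δ₁ δ₂ ≠ 0`. -/
structure GHat where
  dom : Set ℝ
  isOpen_dom : IsOpen dom
  isConnected_dom : IsConnected dom
  α : ℝ → ℝ
  smooth_α : ContDiffOn ℝ ∞ α dom
  deriv_α_ne_zero : ∀ t ∈ dom, deriv α t ≠ 0
  δ₁ : ℝ
  δ₂ : ℝ
  δ₃ : ℝ
  δ₄ : ℝ
  δ_ne_zero : δ₁ * δ₂ ≠ 0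

/-- The components of the transformation `e` for the arbitrary elements: the coefficients
of `E'` are obtained from those of `E`. -/
structure GHat.MapsCoeffs (e : GHat) (E E' : GardnerEq) : Prop where
  source_subset : e.dom ⊆ E.dom
  target_subset : e.α '' e.dom ⊆ E'.dom
  k_eq : ∀ t ∈ e.dom,
    E'.k (e.α t) = e.δ₁ / (e.δ₂ * deriv e.α t) * (E.k t - 2 * (e.δ₃ / e.δ₂) * E.f t)
  f_eq : ∀ t ∈ e.dom, E'.f (e.α t) = e.δ₁ / (e.δ₂ ^ 2 * deriv e.α t) * E.f t
  g_eq : ∀ t ∈ e.dom, E'.g (e.α t) = e.δ₁ ^ 3 / deriv e.α t * E.g t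

/-- The components of the transformation `e` for the variables `t`, `x`, `u`, evaluated at the
equation `E`: on `Ω`, the map `Φ` is given by
`t' = α(t)`, `x' = δ₁ x + (δ₁ δ₃ / δ₂²) ∫ (δ₂ k - δ₃ f) dt + δ₄`, `u' = δ₂ u + δ₃`,
where the indefinite integral is some antiderivative `H`. -/
def GHat.MapsVariables (e : GHat) (E : GardnerEq) (Ω : Set (ℝ × ℝ × ℝ))
    (Φ : ℝ × ℝ × ℝ → ℝ × ℝ × ℝ) : Prop :=
  ∃ H : ℝ → ℝ, (∀ t ∈ e.dom, HasDerivAt H (e.δ₂ * E.k t - e.δ₃ * E.f t) t) ∧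
    ∀ p ∈ Ω, p.1 ∈ e.dom ∧
      Φ p = (e.α p.1, e.δ₁ * p.2.1 + e.δ₁ * e.δ₃ / e.δ₂ ^ 2 * H p.1 + e.δ₄, e.δ₂ * p.2.2 + e.δ₃)

/-- The triple `(E, Φ, E')`, with `Φ` considered on the domain `Ω`, is induced by a transformation
from the generalized extended equivalence group. -/
def IsInduced (E E' : GardnerEq) (Ω : Set (ℝ × ℝ × ℝ)) (Φ : ℝ × ℝ × ℝ → ℝ × ℝ × ℝ) : Prop :=
  IsOpen Ω ∧ IsConnected Ω ∧ ∃ e : GHat, e.MapsCoeffs E E' ∧ e.MapsVariables E Ω Φ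

/-! Write an admissible map as `(T, X, U)`. Choose freely the jet of a polynomial `v` in the target
space and pull `v` back through the map: the implicit function theorem provides a `u` whose graph
goes to that of `v`, provided that `U_u - v_t T_u - v_x X_u ≠ 0`. The chain rule relates the two
jets, and the equivalence of the two equations at the point then becomes algebraic conditions in
free parameters (`IsAdmissible.exists_jet`), which can be separated.

The derivative `v_ttt` enters no equation of the class, which forces `T_x = T_u = 0`. Varying
`v_xxx` gives `g J ^ 3 = T_t g'(T) (U_u - v_x X_u) ^ 3`, where `J` is the Jacobian of `(X, U)` in
`(x, u)` and `g'` is the coefficient of the target equation; the left side does not involve `v_x`,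
so `X_u = 0`. The remaining relation `g X_x ^ 3 = T_t g'(T)` shows that `X_x` is independent of `x`,
and the terms with `u_xx` give `U_xu = U_uu = 0`. What is left is affine in `v_x` and splits into
the two identities of `IsAdmissible.affine_eq`.

Differentiating the first identity twice along a fibre `t = const`, and using that the coefficient
of the quadratic nonlinearity never vanishes, gives `U_x = 0`. The second identity then gives `U_t =
0`, and an `x`-derivative of the first gives `X_tx = 0`. Hence `X_x` and `U_u` are constants on the
connected domain, and the surviving relations are the formulas of the group. The absence of
functional freedom in these two quantities is what normalizes the class.

Conversely, substitution of the formulas turns `α_t` times the left side of the target equation into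
`δ₂` times the left side of the source equation (`InducedData.holds_iff`). Composition and inversion
are computations with the parameters. -/

/-! ### Third-order jets of functions of one variable -/

/-- The function `y` is three times differentiable at `x`, and the values at `x` of `y` and of its
first three derivatives are `y₀`, `y₁`, `y₂`, `y₃`. -/
def HasJetAt (y : ℝ → ℝ) (x y₀ y₁ y₂ y₃ : ℝ) : Prop :=
  ∃ y' y'' : ℝ → ℝ, y x = y₀ ∧ y' x = y₁ ∧ y'' x = y₂ ∧
    (∀ᶠ s in 𝓝 x, HasDerivAt y (y' s) s) ∧ (∀ᶠ s in 𝓝 x, HasDerivAt y' (y'' s) s) ∧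
    HasDerivAt y'' y₃ x

namespace HasJetAt

variable {y z : ℝ → ℝ} {x y₀ y₁ y₂ y₃ z₀ z₁ z₂ z₃ : ℝ}

theorem eq_value (h : HasJetAt y x y₀ y₁ y₂ y₃) : y x = y₀ := by
  obtain ⟨_, _, h₀, -⟩ := h
  exact h₀

theorem hasDerivAt (h : HasJetAt y x y₀ y₁ y₂ y₃) : HasDerivAt y y₁ x := by
  obtain ⟨y', y'', -, h₁, -, hy, -⟩ := h
  exact h₁ ▸ hy.self_of_nhds

theorem deriv_deriv (h : HasJetAt y x y₀ y₁ y₂ y₃) : deriv (deriv y) x = y₂ := by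
  obtain ⟨y', y'', -, -, h₂, hy, hy', -⟩ := h
  have e₁ : deriv y =ᶠ[𝓝 x] y' := hy.mono fun s hs => hs.deriv
  rw [e₁.deriv_eq, hy'.self_of_nhds.deriv, h₂]

theorem iteratedDeriv_three (h : HasJetAt y x y₀ y₁ y₂ y₃) : iteratedDeriv 3 y x = y₃ := by
  obtain ⟨y', y'', -, -, -, hy, hy', hy''⟩ := h
  have e₁ : deriv y =ᶠ[𝓝 x] y' := hy.mono fun s hs => hs.deriv
  have e₂ : deriv y' =ᶠ[𝓝 x] y'' := hy'.mono fun s hs => hs.deriv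
  simp only [iteratedDeriv_succ, iteratedDeriv_zero]
  rw [(e₁.deriv.trans e₂).deriv_eq, hy''.deriv]

theorem congr (h : HasJetAt y x y₀ y₁ y₂ y₃) (e : z =ᶠ[𝓝 x] y) :
    HasJetAt z x y₀ y₁ y₂ y₃ := by
  obtain ⟨y', y'', h₀, h₁, h₂, hy, hy', hy''⟩ := h
  refine ⟨y', y'', e.self_of_nhds.trans h₀, h₁, h₂, ?_, hy', hy''⟩
  filter_upwards [hy, e.eventually_nhds] with s hs es
  exact hs.congr_of_eventuallyEq es

theorem unique (h : HasJetAt y x y₀ y₁ y₂ y₃) (h' : HasJetAt y x z₀ z₁ z₂ z₃) :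
    y₀ = z₀ ∧ y₁ = z₁ ∧ y₂ = z₂ ∧ y₃ = z₃ :=
  ⟨h.eq_value.symm.trans h'.eq_value, h.hasDerivAt.unique h'.hasDerivAt,
    h.deriv_deriv.symm.trans h'.deriv_deriv,
    h.iteratedDeriv_three.symm.trans h'.iteratedDeriv_three⟩

theorem const (c x : ℝ) : HasJetAt (fun _ => c) x c 0 0 0 :=
  ⟨fun _ => 0, fun _ => 0, rfl, rfl, rfl, .of_forall fun s => hasDerivAt_const s c,
    .of_forall fun s => hasDerivAt_const s 0, hasDerivAt_const x 0⟩

theorem id (x : ℝ) : HasJetAt (fun s => s) x x 1 0 0 :=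
  ⟨fun _ => 1, fun _ => 0, rfl, rfl, rfl, .of_forall fun s => hasDerivAt_id s,
    .of_forall fun s => hasDerivAt_const s 1, hasDerivAt_const x 0⟩

theorem add (h : HasJetAt y x y₀ y₁ y₂ y₃) (h' : HasJetAt z x z₀ z₁ z₂ z₃) :
    HasJetAt (fun s => y s + z s) x (y₀ + z₀) (y₁ + z₁) (y₂ + z₂) (y₃ + z₃) := by
  obtain ⟨y', y'', rfl, rfl, rfl, hy, hy', hy''⟩ := h
  obtain ⟨z', z'', rfl, rfl, rfl, hz, hz', hz''⟩ := h'
  refine ⟨fun s => y' s + z' s, fun s => y'' s + z'' s, rfl, rfl, rfl, ?_, ?_, hy''.add hz''⟩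
  · filter_upwards [hy, hz] with s h₁ h₂ using h₁.add h₂
  · filter_upwards [hy', hz'] with s h₁ h₂ using h₁.add h₂

theorem mul (h : HasJetAt y x y₀ y₁ y₂ y₃) (h' : HasJetAt z x z₀ z₁ z₂ z₃) :
    HasJetAt (fun s => y s * z s) x (y₀ * z₀) (y₁ * z₀ + y₀ * z₁)
      (y₂ * z₀ + 2 * (y₁ * z₁) + y₀ * z₂)
      (y₃ * z₀ + 3 * (y₂ * z₁) + 3 * (y₁ * z₂) + y₀ * z₃) := by
  obtain ⟨y', y'', rfl, rfl, rfl, hy, hy', hy''⟩ := h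
  obtain ⟨z', z'', rfl, rfl, rfl, hz, hz', hz''⟩ := h'
  refine ⟨fun s => y' s * z s + y s * z' s,
    fun s => (y'' s * z s + y' s * z' s) + (y' s * z' s + y s * z'' s), rfl, rfl, by ring,
    ?_, ?_, ?_⟩
  · filter_upwards [hy, hz] with s h₁ h₂ using h₁.mul h₂
  · filter_upwards [hy, hz, hy', hz'] with s h₁ h₂ h₃ h₄ using (h₃.mul h₂).add (h₁.mul h₄)
  · have hy := hy.self_of_nhds
    have hz := hz.self_of_nhds
    have hy' := hy'.self_of_nhds
    have hz' := hz'.self_of_nhds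
    refine (((hy''.mul hz).add (hy'.mul hz')).add ((hy'.mul hz').add (hy.mul hz''))).congr_deriv ?_
    ring

theorem of_contDiffAt (h : ContDiffAt ℝ ∞ y x) :
    HasJetAt y x (y x) (deriv y x) (deriv (deriv y) x) (iteratedDeriv 3 y x) := by
  have d : ∀ {w : ℝ → ℝ}, ContDiffAt ℝ ∞ w x → ∀ᶠ s in 𝓝 x, HasDerivAt w (deriv w s) s := by
    intro w hw
    filter_upwards [(hw.of_le (show (1 : ℕ∞ω) ≤ ∞ by simp)).eventually (by simp)] with s hs
    exact (hs.differentiableAt one_ne_zero).hasDerivAt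
  have e : ∀ {w : ℝ → ℝ}, ContDiffAt ℝ ∞ w x → ContDiffAt ℝ ∞ (deriv w) x := fun {w} hw =>
    (hw.fderiv_right (m := ∞) (by simp)).clm_apply (contDiffAt_const (c := (1 : ℝ)))
  have h' := e h
  have h'' := e h'
  refine ⟨deriv y, deriv (deriv y), rfl, rfl, rfl, d h, d h', ?_⟩
  simp only [iteratedDeriv_succ, iteratedDeriv_zero]
  exact (d h'').self_of_nhds

end HasJetAt

/-! ### Partial derivatives of functions of three variables -/

/-- The derivative of `F` in the direction `w`, as a function of the point. -/
noncomputable def dirDeriv (w : ℝ × ℝ × ℝ) (F : ℝ × ℝ × ℝ → ℝ) (p : ℝ × ℝ × ℝ) : ℝ :=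
  fderiv ℝ F p w

local notation "∂ₜ" => dirDeriv (1, 0, 0)
local notation "∂ₓ" => dirDeriv (0, 1, 0)
local notation "∂ᵤ" => dirDeriv (0, 0, 1)

section Partial

variable {Ω : Set (ℝ × ℝ × ℝ)} {F F' : ℝ × ℝ × ℝ → ℝ} {p : ℝ × ℝ × ℝ}

theorem hasFDerivAt_of_contDiffOn_isOpen (hΩ : IsOpen Ω) (hF : ContDiffOn ℝ ∞ F Ω) (hp : p ∈ Ω) :
    HasFDerivAt F (fderiv ℝ F p) p :=
  ((hF.contDiffAt (hΩ.mem_nhds hp)).differentiableAt (by simp)).hasFDerivAt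

theorem fderiv_apply_eq_partial (F : ℝ × ℝ × ℝ → ℝ) (p w : ℝ × ℝ × ℝ) :
    fderiv ℝ F p w = w.1 * ∂ₜ F p + w.2.1 * ∂ₓ F p + w.2.2 * ∂ᵤ F p := by
  obtain ⟨a, b, c⟩ := w
  have : ((a, b, c) : ℝ × ℝ × ℝ) = a • (1, 0, 0) + b • (0, 1, 0) + c • (0, 0, 1) := by simp
  rw [this, map_add, map_add, map_smul, map_smul, map_smul]
  simp [dirDeriv]

theorem hasDerivAt_comp_path (hΩ : IsOpen Ω) (hF : ContDiffOn ℝ ∞ F Ω) {γ : ℝ → ℝ × ℝ × ℝ}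
    {s : ℝ} {w : ℝ × ℝ × ℝ} (hγ : HasDerivAt γ w s) (hp : γ s ∈ Ω) :
    HasDerivAt (fun s => F (γ s)) (w.1 * ∂ₜ F (γ s) + w.2.1 * ∂ₓ F (γ s) + w.2.2 * ∂ᵤ F (γ s)) s := by
  rw [← fderiv_apply_eq_partial]
  exact (hasFDerivAt_of_contDiffOn_isOpen hΩ hF hp).comp_hasDerivAt s hγ

theorem contDiffOn_dirDeriv (hΩ : IsOpen Ω) (hF : ContDiffOn ℝ ∞ F Ω) (w : ℝ × ℝ × ℝ) :
    ContDiffOn ℝ ∞ (dirDeriv w F) Ω :=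
  (hF.fderiv_of_isOpen hΩ (by simp)).clm_apply contDiffOn_const

theorem dirDeriv_comm (hΩ : IsOpen Ω) (hF : ContDiffOn ℝ ∞ F Ω) (hp : p ∈ Ω) (w w' : ℝ × ℝ × ℝ) :
    dirDeriv w (dirDeriv w' F) p = dirDeriv w' (dirDeriv w F) p := by
  have hs : IsSymmSndFDerivAt ℝ F p :=
    (hF.contDiffAt (hΩ.mem_nhds hp)).isSymmSndFDerivAt
      (by simpa using WithTop.coe_le_coe.2 (le_top (a := (2 : ℕ∞))))
  have hd : DifferentiableAt ℝ (fderiv ℝ F) p :=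
    ((hF.fderiv_of_isOpen hΩ (m := ∞) (by simp)).contDiffAt (hΩ.mem_nhds hp)).differentiableAt
      (by simp)
  have key : ∀ a b, dirDeriv a (dirDeriv b F) p = fderiv ℝ (fderiv ℝ F) p a b := by
    intro a b
    have := (hd.hasFDerivAt.clm_apply (hasFDerivAt_const b p)).fderiv
    unfold dirDeriv
    rw [this]
    simp
  rw [key, key, hs.eq]

theorem dirDeriv_congr (hΩ : IsOpen Ω) (h : ∀ q ∈ Ω, F q = F' q) (hp : p ∈ Ω) (w : ℝ × ℝ × ℝ) :
    dirDeriv w F p = dirDeriv w F' p := by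
  have : F =ᶠ[𝓝 p] F' := by filter_upwards [hΩ.mem_nhds hp] with q hq using h q hq
  simp [dirDeriv, this.fderiv_eq]

theorem dirDeriv_eq_zero (hΩ : IsOpen Ω) {c : ℝ} (h : ∀ q ∈ Ω, F q = c) (hp : p ∈ Ω)
    (w : ℝ × ℝ × ℝ) : dirDeriv w F p = 0 := by
  rw [dirDeriv_congr (F' := fun _ => c) hΩ h hp]
  simp [dirDeriv]

theorem hasDerivAt_line (hΩ : IsOpen Ω) (hF : ContDiffOn ℝ ∞ F Ω) (hp : p ∈ Ω) (w : ℝ × ℝ × ℝ) :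
    HasDerivAt (fun s : ℝ => F (p + s • w)) (dirDeriv w F p) 0 := by
  have h : HasFDerivAt F (fderiv ℝ F p) (p + (0 : ℝ) • w) := by
    simpa using hasFDerivAt_of_contDiffOn_isOpen hΩ hF hp
  have hl : HasDerivAt (fun s : ℝ => p + s • w) w 0 := by
    simpa using ((hasDerivAt_id (0 : ℝ)).smul_const w).const_add p
  exact h.comp_hasDerivAt 0 hl

theorem eventually_line_mem (hΩ : IsOpen Ω) (hp : p ∈ Ω) (w : ℝ × ℝ × ℝ) :
    ∀ᶠ s : ℝ in 𝓝 0, p + s • w ∈ Ω := by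
  have hc : ContinuousAt (fun s : ℝ => p + s • w) 0 := by fun_prop
  exact hc.eventually_mem (hΩ.mem_nhds (by simpa using hp))

theorem exists_eq_of_hasFDerivAt_zero (hΩ : IsOpen Ω) (hc : IsConnected Ω)
    (h : ∀ q ∈ Ω, HasFDerivAt F (0 : ℝ × ℝ × ℝ →L[ℝ] ℝ) q) : ∃ c, ∀ q ∈ Ω, F q = c :=
  hΩ.exists_is_const_of_fderiv_eq_zero (𝕜 := ℝ) hc.isPreconnected
    (fun q hq => (h q hq).differentiableAt.differentiableWithinAt) fun q hq => (h q hq).fderiv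

theorem exists_eq_of_partial_eq_zero (hΩ : IsOpen Ω) (hc : IsConnected Ω)
    (hF : DifferentiableOn ℝ F Ω)
    (h : ∀ q ∈ Ω, ∂ₜ F q = 0 ∧ ∂ₓ F q = 0 ∧ ∂ᵤ F q = 0) : ∃ c, ∀ q ∈ Ω, F q = c := by
  refine hΩ.exists_is_const_of_fderiv_eq_zero (𝕜 := ℝ) hc.isPreconnected hF fun q hq => ?_
  obtain ⟨h₁, h₂, h₃⟩ := h q hq
  refine ContinuousLinearMap.ext fun w => ?_
  rw [fderiv_apply_eq_partial, h₁, h₂, h₃]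
  simp

/-- The first derivative of `F` along a curve `x ↦ (t, x, φ x)` with `φ' = φ₁`. -/
noncomputable def curveDeriv₁ (F : ℝ × ℝ × ℝ → ℝ) (p : ℝ × ℝ × ℝ) (φ₁ : ℝ) : ℝ :=
  ∂ₓ F p + φ₁ * ∂ᵤ F p

/-- The second derivative of `F` along a curve `x ↦ (t, x, φ x)` with `φ' = φ₁`, `φ'' = φ₂`. -/
noncomputable def curveDeriv₂ (F : ℝ × ℝ × ℝ → ℝ) (p : ℝ × ℝ × ℝ) (φ₁ φ₂ : ℝ) : ℝ :=
  ∂ₓ (∂ₓ F) p + 2 * (φ₁ * ∂ₓ (∂ᵤ F) p) + φ₁ ^ 2 * ∂ᵤ (∂ᵤ F) p + φ₂ * ∂ᵤ F p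

/-- The third derivative of `F` along a curve `x ↦ (t, x, φ x)` with `φ' = φ₁`, `φ'' = φ₂`,
`φ''' = φ₃`. -/
noncomputable def curveDeriv₃ (F : ℝ × ℝ × ℝ → ℝ) (p : ℝ × ℝ × ℝ) (φ₁ φ₂ φ₃ : ℝ) : ℝ :=
  ∂ₓ (∂ₓ (∂ₓ F)) p + 3 * (φ₁ * ∂ₓ (∂ₓ (∂ᵤ F)) p) + 3 * (φ₁ ^ 2 * ∂ₓ (∂ᵤ (∂ᵤ F)) p)
    + φ₁ ^ 3 * ∂ᵤ (∂ᵤ (∂ᵤ F)) p + 3 * (φ₂ * (∂ₓ (∂ᵤ F) p + φ₁ * ∂ᵤ (∂ᵤ F) p)) + φ₃ * ∂ᵤ F p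

/-- The third-order jet of the restriction of `F` to a curve `x ↦ (t, x, φ x)`. -/
theorem HasJetAt.comp_curve (hΩ : IsOpen Ω) (hF : ContDiffOn ℝ ∞ F Ω) {φ : ℝ → ℝ}
    {t x u φ₁ φ₂ φ₃ : ℝ} (hφ : HasJetAt φ x u φ₁ φ₂ φ₃) (hp : (t, x, u) ∈ Ω) :
    HasJetAt (fun s => F (t, s, φ s)) x (F (t, x, u)) (curveDeriv₁ F (t, x, u) φ₁)
      (curveDeriv₂ F (t, x, u) φ₁ φ₂) (curveDeriv₃ F (t, x, u) φ₁ φ₂ φ₃) := by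
  obtain ⟨φ', φ'', rfl, rfl, rfl, hφ, hφ', hφ''⟩ := hφ
  have d : ∀ {K : ℝ × ℝ × ℝ → ℝ} {s : ℝ}, ContDiffOn ℝ ∞ K Ω → (t, s, φ s) ∈ Ω →
      HasDerivAt φ (φ' s) s →
      HasDerivAt (fun s => K (t, s, φ s)) (∂ₓ K (t, s, φ s) + φ' s * ∂ᵤ K (t, s, φ s)) s := by
    intro K s hK hs hd
    have hc : HasDerivAt (fun s => (t, s, φ s)) ((0, 1, φ' s) : ℝ × ℝ × ℝ) s :=
      (hasDerivAt_const s t).prodMk ((hasDerivAt_id s).prodMk hd)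
    exact (hasDerivAt_comp_path hΩ hK hc hs).congr_deriv (by ring)
  have hm : ∀ᶠ s in 𝓝 x, (t, s, φ s) ∈ Ω := by
    have : ContinuousAt φ x := hφ.self_of_nhds.continuousAt
    have hc : ContinuousAt (fun s => (t, s, φ s)) x := by fun_prop
    exact hc.eventually_mem (hΩ.mem_nhds hp)
  have hx := contDiffOn_dirDeriv hΩ hF (0, 1, 0)
  have hu := contDiffOn_dirDeriv hΩ hF (0, 0, 1)
  have hxx := contDiffOn_dirDeriv hΩ hx (0, 1, 0)
  have hxu := contDiffOn_dirDeriv hΩ hu (0, 1, 0)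
  have huu := contDiffOn_dirDeriv hΩ hu (0, 0, 1)
  refine ⟨fun s => ∂ₓ F (t, s, φ s) + φ' s * ∂ᵤ F (t, s, φ s),
    fun s => ∂ₓ (∂ₓ F) (t, s, φ s) + 2 * (φ' s * ∂ₓ (∂ᵤ F) (t, s, φ s))
      + φ' s ^ 2 * ∂ᵤ (∂ᵤ F) (t, s, φ s) + φ'' s * ∂ᵤ F (t, s, φ s), rfl, rfl, rfl, ?_, ?_, ?_⟩
  · filter_upwards [hφ, hm] with s h₁ h₂ using d hF h₂ h₁
  · filter_upwards [hφ, hφ', hm] with s h₁ h₂ h₃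
    refine ((d hx h₃ h₁).add (h₂.mul (d hu h₃ h₁))).congr_deriv ?_
    rw [dirDeriv_comm hΩ hF h₃ (0, 0, 1) (0, 1, 0)]
    ring
  · have h₁ := hφ.self_of_nhds
    have h₂ := hφ'.self_of_nhds
    refine ((((d hxx hp h₁).add ((h₂.mul (d hxu hp h₁)).const_mul 2)).add
      ((h₂.fun_pow 2).mul (d huu hp h₁))).add (hφ''.mul (d hu hp h₁))).congr_deriv ?_
    -- Mixed third derivatives are put in the order used by `curveDeriv₃`, with the `x`-derivatives
    -- outermost.
    have e₁ : ∂ᵤ (∂ₓ (∂ₓ F)) (t, x, φ x) = ∂ₓ (∂ₓ (∂ᵤ F)) (t, x, φ x) := by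
      rw [dirDeriv_comm hΩ hx hp]
      exact dirDeriv_congr hΩ (fun q hq => dirDeriv_comm hΩ hF hq _ _) hp _
    have e₂ : ∂ᵤ (∂ₓ (∂ᵤ F)) (t, x, φ x) = ∂ₓ (∂ᵤ (∂ᵤ F)) (t, x, φ x) := dirDeriv_comm hΩ hu hp _ _
    rw [e₁, e₂, curveDeriv₃]
    push_cast
    ring

end Partial

/-! ### Action of a point transformation on third-order jets -/

/-- A polynomial in `t - t₀` and `x - x₀` with prescribed jet at `(t₀, x₀)`. -/
noncomputable def testPoly (t₀ x₀ v₀ a b c₂ c₃ c t x : ℝ) : ℝ :=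
  v₀ + a * (t - t₀) + b * (x - x₀) + c₂ / 2 * ((x - x₀) * (x - x₀))
    + c₃ / 6 * ((x - x₀) * ((x - x₀) * (x - x₀))) + c / 6 * ((t - t₀) * ((t - t₀) * (t - t₀)))

theorem contDiff_testPoly (t₀ x₀ v₀ a b c₂ c₃ c : ℝ) :
    ContDiff ℝ ∞ fun q : ℝ × ℝ => testPoly t₀ x₀ v₀ a b c₂ c₃ c q.1 q.2 := by
  unfold testPoly
  fun_prop

/-- The jet at a point of the composition of `testPoly` with two functions of one variable. -/
theorem HasJetAt.testPoly {y z : ℝ → ℝ} {s y₀ y₁ y₂ y₃ z₀ z₁ z₂ z₃ : ℝ}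
    (hy : HasJetAt y s y₀ y₁ y₂ y₃) (hz : HasJetAt z s z₀ z₁ z₂ z₃) (v₀ a b c₂ c₃ c : ℝ) :
    HasJetAt (fun s => testPoly y₀ z₀ v₀ a b c₂ c₃ c (y s) (z s)) s v₀ (a * y₁ + b * z₁)
      (a * y₂ + b * z₂ + c₂ * z₁ ^ 2)
      (a * y₃ + b * z₃ + 3 * c₂ * z₁ * z₂ + c₃ * z₁ ^ 3 + c * y₁ ^ 3) := by
  have hy' := hy.add (.const (-y₀) s)
  have hz' := hz.add (.const (-z₀) s)
  have h := (((((HasJetAt.const v₀ s).add ((HasJetAt.const a s).mul hy')).add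
    ((HasJetAt.const b s).mul hz')).add ((HasJetAt.const (c₂ / 2) s).mul (hz'.mul hz'))).add
    ((HasJetAt.const (c₃ / 6) s).mul (hz'.mul (hz'.mul hz')))).add
    ((HasJetAt.const (c / 6) s).mul (hy'.mul (hy'.mul hy')))
  simp only [_root_.testPoly, sub_eq_add_neg]
  convert h using 1 <;> ring

/-- The components `c₂` and `c` of the jet, that is `v_xx` and `v_ttt`, drop out. The freedom to
vary them without affecting the equation drives the separation of the determining equations. -/
theorem holdsAt_testPoly_iff (E : GardnerEq) (t₀ x₀ v₀ a b c₂ c₃ c : ℝ) :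
    E.HoldsAt (testPoly t₀ x₀ v₀ a b c₂ c₃ c) t₀ x₀ ↔
      a + (E.k t₀ * v₀ + E.f t₀ * v₀ ^ 2) * b + E.g t₀ * c₃ = 0 := by
  have hx := (HasJetAt.const t₀ x₀).testPoly (HasJetAt.id x₀) v₀ a b c₂ c₃ c
  have ht := (HasJetAt.id t₀).testPoly (HasJetAt.const x₀ t₀) v₀ a b c₂ c₃ c
  have h₁ := hx.hasDerivAt.deriv
  have h₂ := hx.iteratedDeriv_three
  have h₃ := ht.hasDerivAt.deriv
  have h₀ := hx.eq_value
  simp only [GardnerEq.HoldsAt]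
  rw [show deriv (testPoly t₀ x₀ v₀ a b c₂ c₃ c t₀) x₀ = _ from h₁,
    show iteratedDeriv 3 (testPoly t₀ x₀ v₀ a b c₂ c₃ c t₀) x₀ = _ from h₂, h₃,
    show testPoly t₀ x₀ v₀ a b c₂ c₃ c t₀ x₀ = _ from h₀]
  ring_nf

/-- The implicit function theorem for one equation in three variables. -/
theorem exists_implicit_solution {G : ℝ × ℝ × ℝ → ℝ} {t x u d : ℝ}
    (hG : ContDiffAt ℝ ∞ G (t, x, u)) (hd : HasDerivAt (fun s => G (t, x, s)) d u) (h0 : d ≠ 0) :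
    ∃ w : ℝ → ℝ → ℝ, w t x = u ∧ ContDiffAt ℝ ∞ (fun q : ℝ × ℝ => w q.1 q.2) (t, x) ∧
      ∀ᶠ q : ℝ × ℝ in 𝓝 (t, x), G (q.1, q.2, w q.1 q.2) = G (t, x, u) := by
  let K : (ℝ × ℝ) × ℝ → ℝ := fun q => G (q.1.1, q.1.2, q.2)
  have hK : ContDiffAt ℝ ∞ K ((t, x), u) := by
    have hl : ContDiffAt ℝ ∞ (fun q : (ℝ × ℝ) × ℝ => (q.1.1, q.1.2, q.2)) ((t, x), u) := by fun_prop
    exact ContDiffAt.comp ((t, x), u) (g := G) hG hl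
  have hKd : HasFDerivAt (fun s => K ((t, x), s))
      (fderiv ℝ K ((t, x), u) ∘L .inr ℝ (ℝ × ℝ) ℝ) u :=
    (hK.differentiableAt (by simp)).hasFDerivAt.comp u (hasFDerivAt_prodMk_right (t, x) u)
  have hinv : (fderiv ℝ K ((t, x), u) ∘L .inr ℝ (ℝ × ℝ) ℝ).IsInvertible := by
    rw [hKd.unique hd.hasFDerivAt]
    exact ⟨ContinuousLinearEquiv.unitsEquivAut ℝ (Units.mk0 d h0), by ext; simp⟩
  refine ⟨fun t x => hK.implicitFunction (by simp) hinv (t, x),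
    hK.implicitFunction_apply_self (by simp) hinv,
    hK.contDiffAt_implicitFunction (by simp) hinv, ?_⟩
  exact hK.eventually_apply_implicitFunction (by simp) hinv

/-- The condition imposed on the jets at a point by an admissible transformation. Here `a`, `b`,
`c₂`, `c₃`, `c` are components of the jet of the transformed function and `ψ`, `φ₁`, `φ₂`, `φ₃` are
the values of `u_t`, `u_x`, `u_xx`, `u_xxx`. -/
theorem IsAdmissible.exists_jet {E E' : GardnerEq} {Ω : Set (ℝ × ℝ × ℝ)}
    {T X U : ℝ × ℝ × ℝ → ℝ} (h : IsAdmissible E E' Ω fun p => (T p, X p, U p))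
    {p : ℝ × ℝ × ℝ} (hp : p ∈ Ω) (a b c₂ c₃ c : ℝ)
    (h0 : ∂ᵤ U p - a * ∂ᵤ T p - b * ∂ᵤ X p ≠ 0) :
    ∃ ψ φ₁ φ₂ φ₃ : ℝ,
      ∂ₜ U p + ψ * ∂ᵤ U p = a * (∂ₜ T p + ψ * ∂ᵤ T p) + b * (∂ₜ X p + ψ * ∂ᵤ X p) ∧
      curveDeriv₁ U p φ₁ = a * curveDeriv₁ T p φ₁ + b * curveDeriv₁ X p φ₁ ∧
      curveDeriv₂ U p φ₁ φ₂ = a * curveDeriv₂ T p φ₁ φ₂ + b * curveDeriv₂ X p φ₁ φ₂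
        + c₂ * curveDeriv₁ X p φ₁ ^ 2 ∧
      curveDeriv₃ U p φ₁ φ₂ φ₃ = a * curveDeriv₃ T p φ₁ φ₂ φ₃ + b * curveDeriv₃ X p φ₁ φ₂ φ₃
        + 3 * c₂ * curveDeriv₁ X p φ₁ * curveDeriv₂ X p φ₁ φ₂ + c₃ * curveDeriv₁ X p φ₁ ^ 3
        + c * curveDeriv₁ T p φ₁ ^ 3 ∧
      (ψ + (E.k p.1 * p.2.2 + E.f p.1 * p.2.2 ^ 2) * φ₁ + E.g p.1 * φ₃ = 0 ↔
        a + (E'.k (T p) * U p + E'.f (T p) * U p ^ 2) * b + E'.g (T p) * c₃ = 0) := by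
  obtain ⟨t, x, u⟩ := p
  have hΩ := h.isPointTransformation.isOpen
  have hΦ := h.isPointTransformation.smooth
  have hT : ContDiffOn ℝ ∞ T Ω := hΦ.fst
  have hX : ContDiffOn ℝ ∞ X Ω := hΦ.snd.fst
  have hU : ContDiffOn ℝ ∞ U Ω := hΦ.snd.snd
  set p : ℝ × ℝ × ℝ := (t, x, u) with hpdef
  set v := testPoly (T p) (X p) (U p) a b c₂ c₃ c with hv
  have hvs : ContDiff ℝ ∞ fun q : ℝ × ℝ => v q.1 q.2 := contDiff_testPoly _ _ _ _ _ _ _ _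
  have hvd : ∀ {y z : ℝ → ℝ} {s y₁ z₁ : ℝ}, y s = T p → z s = X p → HasDerivAt y y₁ s →
      HasDerivAt z z₁ s → HasDerivAt (fun s => v (y s) (z s)) (a * y₁ + b * z₁) s := by
    intro y z s y₁ z₁ h1 h2 hy hz
    have hy' := hy.sub_const (T p)
    have hz' := hz.sub_const (X p)
    refine (((((hy'.const_mul a).const_add (U p)).add (hz'.const_mul b)).add
      ((hz'.mul hz').const_mul (c₂ / 2))).add ((hz'.mul (hz'.mul hz')).const_mul (c₃ / 6))).add
      ((hy'.mul (hy'.mul hy')).const_mul (c / 6)) |>.congr_deriv ?_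
    simp [h1, h2]
  have hGs : ContDiffAt ℝ ∞ (fun q => U q - v (T q) (X q)) p := by
    have hn := hΩ.mem_nhds hp
    exact (hU.contDiffAt hn).sub
      (hvs.contDiffAt.comp p ((hT.contDiffAt hn).prodMk (hX.contDiffAt hn)))
  have hγu : HasDerivAt (fun s => ((t, x, s) : ℝ × ℝ × ℝ)) (0, 0, 1) u :=
    (hasDerivAt_const u t).prodMk ((hasDerivAt_const u x).prodMk (hasDerivAt_id u))
  have hGd : HasDerivAt (fun s => U (t, x, s) - v (T (t, x, s)) (X (t, x, s)))
      (∂ᵤ U p - a * ∂ᵤ T p - b * ∂ᵤ X p) u := by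
    refine ((hasDerivAt_comp_path hΩ hU hγu hp).sub (hvd rfl rfl
      (hasDerivAt_comp_path hΩ hT hγu hp) (hasDerivAt_comp_path hΩ hX hγu hp))).congr_deriv ?_
    simp only [hpdef]
    ring
  -- The pullback `w` of `v` solves `U = v(T, X)` for `u`; `h0` says that the `u`-derivative of the
  -- difference of the two sides is nonzero at `p`.
  obtain ⟨w, hwp, hws, hw⟩ := exists_implicit_solution hGs hGd h0
  have hGp : U p - v (T p) (X p) = 0 := by simp [hv, testPoly]
  simp only [← hpdef, hGp] at hw
  have hwx : ContDiffAt ℝ ∞ (w t) x :=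
    ContDiffAt.comp x (g := fun q : ℝ × ℝ => w q.1 q.2) (f := fun s => (t, s)) hws (by fun_prop)
  have hwt : ContDiffAt ℝ ∞ (fun s => w s x) t :=
    ContDiffAt.comp t (g := fun q : ℝ × ℝ => w q.1 q.2) (f := fun s => (s, x)) hws (by fun_prop)
  have hj := HasJetAt.of_contDiffAt hwx
  rw [hwp] at hj
  have jT := hj.comp_curve hΩ hT hp
  have jX := hj.comp_curve hΩ hX hp
  have jU := hj.comp_curve hΩ hU hp
  have evx : ∀ᶠ s in 𝓝 x, U (t, s, w t s) = v (T (t, s, w t s)) (X (t, s, w t s)) := by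
    have hc : Tendsto (fun s => (t, s)) (𝓝 x) (𝓝 (t, x)) :=
      Continuous.tendsto (by fun_prop) x
    filter_upwards [hc.eventually hw] with s hs using sub_eq_zero.1 hs
  have evt : ∀ᶠ s in 𝓝 t, U (s, x, w s x) = v (T (s, x, w s x)) (X (s, x, w s x)) := by
    have hc : Tendsto (fun s => (s, x)) (𝓝 t) (𝓝 (t, x)) :=
      Continuous.tendsto (by fun_prop) t
    filter_upwards [hc.eventually hw] with s hs using sub_eq_zero.1 hs
  -- Both sides of `U = v(T, X)` are restricted to the line `t = const` on the graph of `w` and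
  -- their third-order jets are compared.
  obtain ⟨-, e₁, e₂, e₃⟩ := jU.unique ((jT.testPoly jX (U p) a b c₂ c₃ c).congr evx)
  have hγt : HasDerivAt (fun s => ((s, x, w s x) : ℝ × ℝ × ℝ)) (1, 0, deriv (fun s => w s x) t) t :=
    (hasDerivAt_id t).prodMk ((hasDerivAt_const t x).prodMk
      (hwt.differentiableAt (by simp)).hasDerivAt)
  have hpt : (t, x, w t x) = p := by rw [hwp]
  have hpt' : (t, x, w t x) ∈ Ω := hpt ▸ hp
  have et := (hasDerivAt_comp_path hΩ hU hγt hpt').unique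
    ((hvd (by rw [hpt]) (by rw [hpt]) (hasDerivAt_comp_path hΩ hT hγt hpt')
      (hasDerivAt_comp_path hΩ hX hγt hpt')).congr_of_eventuallyEq evt)
  rw [hpt] at et
  refine ⟨deriv (fun s => w s x) t, deriv (w t) x, deriv (deriv (w t)) x,
    iteratedDeriv 3 (w t) x, by linear_combination et, e₁, e₂, e₃, ?_⟩
  have hiff := h.holds_iff t x w v hpt' hws hvs.contDiffAt (by
    filter_upwards [hw] with q hq using (sub_eq_zero.1 hq).symm)
  simp only [hpt] at hiff
  rw [hv, holdsAt_testPoly_iff] at hiff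
  rw [← hiff, GardnerEq.HoldsAt, hwp]
  simp only [hpdef]
  ring_nf

/-! ### Determining equations of admissible transformations -/

theorem bijective_of_det_ne_zero {L : ℝ × ℝ × ℝ →L[ℝ] ℝ × ℝ × ℝ} (h : L.det ≠ 0) :
    Function.Bijective L :=
  (LinearMap.equivOfDetNeZero (L : ℝ × ℝ × ℝ →ₗ[ℝ] ℝ × ℝ × ℝ) h).bijective

namespace IsAdmissible

variable {E E' : GardnerEq} {Ω : Set (ℝ × ℝ × ℝ)} {T X U : ℝ × ℝ × ℝ → ℝ} {p : ℝ × ℝ × ℝ}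

theorem fderiv_apply (h : IsAdmissible E E' Ω fun p => (T p, X p, U p)) (hp : p ∈ Ω)
    (w : ℝ × ℝ × ℝ) : fderiv ℝ (fun p => (T p, X p, U p)) p w =
      (w.1 * ∂ₜ T p + w.2.1 * ∂ₓ T p + w.2.2 * ∂ᵤ T p,
        w.1 * ∂ₜ X p + w.2.1 * ∂ₓ X p + w.2.2 * ∂ᵤ X p,
        w.1 * ∂ₜ U p + w.2.1 * ∂ₓ U p + w.2.2 * ∂ᵤ U p) := by
  have hΩ := h.isPointTransformation.isOpen
  have hΦ := h.isPointTransformation.smooth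
  rw [((hasFDerivAt_of_contDiffOn_isOpen hΩ hΦ.fst hp).prodMk
    ((hasFDerivAt_of_contDiffOn_isOpen hΩ hΦ.snd.fst hp).prodMk
      (hasFDerivAt_of_contDiffOn_isOpen hΩ hΦ.snd.snd hp))).fderiv]
  simp only [← fderiv_apply_eq_partial]
  rfl

theorem eq_zero_of_jacobian (h : IsAdmissible E E' Ω fun p => (T p, X p, U p)) (hp : p ∈ Ω)
    {b c : ℝ} (hT : b * ∂ₓ T p + c * ∂ᵤ T p = 0) (hX : b * ∂ₓ X p + c * ∂ᵤ X p = 0)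
    (hU : b * ∂ₓ U p + c * ∂ᵤ U p = 0) : b = 0 ∧ c = 0 := by
  have hinj := (bijective_of_det_ne_zero (h.isPointTransformation.nondegenerate p hp)).1
  have : ((0, b, c) : ℝ × ℝ × ℝ) = 0 := by
    apply hinj
    rw [h.fderiv_apply hp, map_zero]
    simp [hT, hX, hU]
  simpa using this

theorem dirDeriv_fst_ne_zero (h : IsAdmissible E E' Ω fun p => (T p, X p, U p)) (hp : p ∈ Ω)
    (hx : ∂ₓ T p = 0) (hu : ∂ᵤ T p = 0) : ∂ₜ T p ≠ 0 := by
  intro ht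
  obtain ⟨w, hw⟩ :=
    (bijective_of_det_ne_zero (h.isPointTransformation.nondegenerate p hp)).2 (1, 0, 0)
  rw [h.fderiv_apply hp, ht, hx, hu] at hw
  simp at hw

theorem source_g_ne_zero (h : IsAdmissible E E' Ω fun p => (T p, X p, U p)) (hp : p ∈ Ω) :
    E.g p.1 ≠ 0 := right_ne_zero_of_mul (E.fg_ne_zero _ (h.source_mem p hp))

theorem target_f_ne_zero (h : IsAdmissible E E' Ω fun p => (T p, X p, U p)) (hp : p ∈ Ω) :
    E'.f (T p) ≠ 0 := left_ne_zero_of_mul (E'.fg_ne_zero _ (h.target_mem p hp))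

theorem target_g_ne_zero (h : IsAdmissible E E' Ω fun p => (T p, X p, U p)) (hp : p ∈ Ω) :
    E'.g (T p) ≠ 0 := right_ne_zero_of_mul (E'.fg_ne_zero _ (h.target_mem p hp))

/-- The coefficient of `u_ttt` in the transformed equation vanishes. -/
theorem curveDeriv₁_fst_eq_zero (h : IsAdmissible E E' Ω fun p => (T p, X p, U p)) (hp : p ∈ Ω)
    {a b : ℝ} (h0 : ∂ᵤ U p - a * ∂ᵤ T p - b * ∂ᵤ X p ≠ 0) :
    ∂ₓ T p * (∂ᵤ U p - b * ∂ᵤ X p) = ∂ᵤ T p * (∂ₓ U p - b * ∂ₓ X p) := by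
  have hg := h.source_g_ne_zero hp
  have hg' := h.target_g_ne_zero hp
  -- This value of `v_xxx` places the jet of `v` on the target equation.
  set c₃ := -(a + (E'.k (T p) * U p + E'.f (T p) * U p ^ 2) * b) / E'.g (T p) with hc₃
  have hE' : a + (E'.k (T p) * U p + E'.f (T p) * U p ^ 2) * b + E'.g (T p) * c₃ = 0 := by
    rw [hc₃]
    field_simp
    ring
  -- The two jets of `v` differ only in `v_ttt`, which is 0 or 1. Both lie on the target equation,
  -- so both pullbacks satisfy the source equation; since `g ≠ 0`, this fixes `u_xxx`, and the two
  -- pulled-back jets coincide.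
  obtain ⟨ψ, φ₁, φ₂, φ₃, et, e₁, e₂, e₃, hE⟩ := h.exists_jet hp a b 0 c₃ 0 h0
  obtain ⟨ψ', φ₁', φ₂', φ₃', et', e₁', e₂', e₃', hE₂⟩ := h.exists_jet hp a b 0 c₃ 1 h0
  have hE := hE.2 hE'
  have hE₂ := hE₂.2 hE'
  simp only [curveDeriv₁, curveDeriv₂, curveDeriv₃] at e₁ e₂ e₃ e₁' e₂' e₃'
  obtain rfl : ψ = ψ' := mul_right_cancel₀ h0 (by linear_combination et - et')
  obtain rfl : φ₁ = φ₁' := mul_right_cancel₀ h0 (by linear_combination e₁ - e₁')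
  obtain rfl : φ₂ = φ₂' := mul_right_cancel₀ h0 (by linear_combination e₂ - e₂')
  obtain rfl : φ₃ = φ₃' := mul_left_cancel₀ hg (by linear_combination hE - hE₂)
  have h3 : (∂ₓ T p + φ₁ * ∂ᵤ T p) ^ 3 = 0 := by linear_combination e₃ - e₃'
  have h1 := pow_eq_zero_iff (three_ne_zero) |>.1 h3
  linear_combination (∂ᵤ U p - a * ∂ᵤ T p - b * ∂ᵤ X p) * h1 - ∂ᵤ T p * e₁

/-- The identity of `curveDeriv₁_fst_eq_zero` is affine in `b`, so two admissible values of `b`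
split it. The two resulting identities say that `(0, T_u, -T_x)` lies in the kernel of the
differential of the map, which is trivial. -/
theorem partial_fst_eq_zero (h : IsAdmissible E E' Ω fun p => (T p, X p, U p)) (hp : p ∈ Ω) :
    ∂ₓ T p = 0 ∧ ∂ᵤ T p = 0 := by
  have key : ∂ₓ T p * ∂ᵤ U p = ∂ᵤ T p * ∂ₓ U p ∧ ∂ₓ T p * ∂ᵤ X p = ∂ᵤ T p * ∂ₓ X p := by
    -- Otherwise the `u`-column of the Jacobian matrix would vanish. This leaves a value of `a` for
    -- which at least two values of `b` meet the nondegeneracy condition.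
    have hcol : ∃ a, ∂ᵤ U p - a * ∂ᵤ T p ≠ 0 ∨ ∂ᵤ X p ≠ 0 := by
      by_contra! hn
      have := h.eq_zero_of_jacobian hp (b := 0) (c := 1)
        (by linear_combination (hn 0).1 - (hn 1).1) (by linear_combination (hn 0).2)
        (by linear_combination (hn 0).1)
      simp at this
    obtain ⟨a, ha⟩ := hcol
    have hb : ∃ b b', b ≠ b' ∧ ∂ᵤ U p - a * ∂ᵤ T p - b * ∂ᵤ X p ≠ 0 ∧
        ∂ᵤ U p - a * ∂ᵤ T p - b' * ∂ᵤ X p ≠ 0 := by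
      by_cases hX : ∂ᵤ X p = 0
      · refine ⟨0, 1, zero_ne_one, ?_, ?_⟩ <;> simpa [hX] using ha
      · refine ⟨(∂ᵤ U p - a * ∂ᵤ T p - 1) / ∂ᵤ X p, (∂ᵤ U p - a * ∂ᵤ T p - 2) / ∂ᵤ X p, ?_, ?_, ?_⟩
        · intro he
          rw [div_left_inj' hX] at he
          linarith
        · rw [div_mul_cancel₀ _ hX]
          norm_num
        · rw [div_mul_cancel₀ _ hX]
          norm_num
    obtain ⟨b, b', hbb, h₁, h₂⟩ := hb
    have k₁ := h.curveDeriv₁_fst_eq_zero hp h₁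
    have k₂ := h.curveDeriv₁_fst_eq_zero hp h₂
    have hX : ∂ₓ T p * ∂ᵤ X p = ∂ᵤ T p * ∂ₓ X p :=
      mul_left_cancel₀ (sub_ne_zero.2 hbb) (by linear_combination k₂ - k₁)
    exact ⟨by linear_combination k₁ + b * hX, hX⟩
  have := h.eq_zero_of_jacobian hp (b := ∂ᵤ T p) (c := -∂ₓ T p) (by ring)
    (by linear_combination -key.2) (by linear_combination -key.1)
  exact ⟨neg_eq_zero.1 this.2, this.1⟩

theorem curveDeriv_fst (h : IsAdmissible E E' Ω fun p => (T p, X p, U p)) (hp : p ∈ Ω)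
    (φ₁ φ₂ φ₃ : ℝ) :
    curveDeriv₁ T p φ₁ = 0 ∧ curveDeriv₂ T p φ₁ φ₂ = 0 ∧ curveDeriv₃ T p φ₁ φ₂ φ₃ = 0 := by
  have hΩ := h.isPointTransformation.isOpen
  have hx : ∀ q ∈ Ω, ∂ₓ T q = 0 := fun q hq => (h.partial_fst_eq_zero hq).1
  have hu : ∀ q ∈ Ω, ∂ᵤ T q = 0 := fun q hq => (h.partial_fst_eq_zero hq).2
  have hxx : ∀ q ∈ Ω, ∂ₓ (∂ₓ T) q = 0 := fun q hq => dirDeriv_eq_zero hΩ hx hq _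
  have hxu : ∀ q ∈ Ω, ∂ₓ (∂ᵤ T) q = 0 := fun q hq => dirDeriv_eq_zero hΩ hu hq _
  have huu : ∀ q ∈ Ω, ∂ᵤ (∂ᵤ T) q = 0 := fun q hq => dirDeriv_eq_zero hΩ hu hq _
  simp [curveDeriv₁, curveDeriv₂, curveDeriv₃, hx p hp, hu p hp, hxx p hp, hxu p hp, huu p hp,
    dirDeriv_eq_zero hΩ hxx hp, dirDeriv_eq_zero hΩ hxu hp, dirDeriv_eq_zero hΩ huu hp]

/-- The equation obtained by eliminating `u_t` and `u_xxx`. -/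
theorem exists_reduced_jet (h : IsAdmissible E E' Ω fun p => (T p, X p, U p)) (hp : p ∈ Ω)
    (b c₂ c₃ : ℝ) (h0 : ∂ᵤ U p - b * ∂ᵤ X p ≠ 0) :
    ∃ φ₁ φ₂ φ₃ : ℝ,
      curveDeriv₁ U p φ₁ = b * curveDeriv₁ X p φ₁ ∧
      curveDeriv₂ U p φ₁ φ₂ = b * curveDeriv₂ X p φ₁ φ₂ + c₂ * curveDeriv₁ X p φ₁ ^ 2 ∧
      curveDeriv₃ U p φ₁ φ₂ φ₃ = b * curveDeriv₃ X p φ₁ φ₂ φ₃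
        + 3 * c₂ * curveDeriv₁ X p φ₁ * curveDeriv₂ X p φ₁ φ₂ + c₃ * curveDeriv₁ X p φ₁ ^ 3 ∧
      b * ∂ₜ X p - ∂ₜ U p + (E.k p.1 * p.2.2 + E.f p.1 * p.2.2 ^ 2) * (b * ∂ₓ X p - ∂ₓ U p)
        + E.g p.1 * (φ₃ * (∂ᵤ U p - b * ∂ᵤ X p)) =
        ∂ₜ T p * ((E'.k (T p) * U p + E'.f (T p) * U p ^ 2) * b + E'.g (T p) * c₃) := by
  -- The value of `v_t` is the one dictated by the target equation. As `T_u = 0`, it does not affect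
  -- the nondegeneracy condition.
  obtain ⟨ψ, φ₁, φ₂, φ₃, et, e₁, e₂, e₃, hE⟩ := h.exists_jet hp
    (-((E'.k (T p) * U p + E'.f (T p) * U p ^ 2) * b + E'.g (T p) * c₃)) b c₂ c₃ 0
    (by rw [(h.partial_fst_eq_zero hp).2]; simpa using h0)
  have hE := hE.2 (by ring)
  obtain ⟨hT₁, hT₂, hT₃⟩ := h.curveDeriv_fst hp φ₁ φ₂ φ₃
  rw [hT₁] at e₁
  rw [hT₂] at e₂
  rw [hT₁, hT₃] at e₃
  rw [(h.partial_fst_eq_zero hp).2] at et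
  refine ⟨φ₁, φ₂, φ₃, by linear_combination e₁, by linear_combination e₂, by linear_combination e₃,
    ?_⟩
  simp only [curveDeriv₁] at e₁
  linear_combination -et - (E.k p.1 * p.2.2 + E.f p.1 * p.2.2 ^ 2) * e₁
    + (∂ᵤ U p - b * ∂ᵤ X p) * hE

theorem jacobian_snd_ne_zero (h : IsAdmissible E E' Ω fun p => (T p, X p, U p)) (hp : p ∈ Ω) :
    ∂ₓ X p * ∂ᵤ U p - ∂ᵤ X p * ∂ₓ U p ≠ 0 := by
  obtain ⟨hTx, hTu⟩ := h.partial_fst_eq_zero hp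
  intro hJ
  obtain ⟨h₁, h₂⟩ := h.eq_zero_of_jacobian hp (b := ∂ᵤ X p) (c := -∂ₓ X p)
    (by simp [hTx, hTu]) (by ring) (by linear_combination -hJ)
  obtain ⟨h₃, h₄⟩ := h.eq_zero_of_jacobian hp (b := ∂ᵤ U p) (c := -∂ₓ U p)
    (by simp [hTx, hTu]) (by linear_combination ∂ᵤ U p * -h₂ - ∂ₓ U p * h₁) (by ring)
  have := h.eq_zero_of_jacobian hp (b := 0) (c := 1) (by simp [hTu]) (by simp [h₁]) (by simp [h₃])
  simp at this

/-- Raising `v_xxx` from 0 to 1 raises `u_xxx (U_u - b X_u)` by the cube of the total derivative of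
`X`, and that derivative times `U_u - b X_u` is the Jacobian. -/
theorem g_mul_jacobian (h : IsAdmissible E E' Ω fun p => (T p, X p, U p)) (hp : p ∈ Ω)
    {b : ℝ} (h0 : ∂ᵤ U p - b * ∂ᵤ X p ≠ 0) :
    E.g p.1 * (∂ₓ X p * ∂ᵤ U p - ∂ᵤ X p * ∂ₓ U p) ^ 3 =
      ∂ₜ T p * E'.g (T p) * (∂ᵤ U p - b * ∂ᵤ X p) ^ 3 := by
  obtain ⟨φ₁, φ₂, φ₃, e₁, e₂, e₃, hE⟩ := h.exists_reduced_jet hp b 0 0 h0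
  obtain ⟨φ₁', φ₂', φ₃', e₁', e₂', e₃', hE'⟩ := h.exists_reduced_jet hp b 0 1 h0
  simp only [curveDeriv₁, curveDeriv₂, curveDeriv₃] at e₁ e₂ e₃ e₁' e₂' e₃'
  obtain rfl : φ₁ = φ₁' := mul_right_cancel₀ h0 (by linear_combination e₁ - e₁')
  obtain rfl : φ₂ = φ₂' := mul_right_cancel₀ h0 (by linear_combination e₂ - e₂')
  have hX : (∂ₓ X p + φ₁ * ∂ᵤ X p) * (∂ᵤ U p - b * ∂ᵤ X p) =
      ∂ₓ X p * ∂ᵤ U p - ∂ᵤ X p * ∂ₓ U p := by linear_combination ∂ᵤ X p * e₁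
  rw [← hX]
  linear_combination (∂ᵤ U p - b * ∂ᵤ X p) ^ 3 * (hE' - hE - E.g p.1 * (e₃' - e₃))

/-- If `X_u ≠ 0`, then `U_u - b X_u` takes every nonzero value `d` as `b` varies, while the left
side of `g_mul_jacobian` stays fixed. The values `d = 1` and `d = 2` are contradictory. -/
theorem partial_snd_eq_zero (h : IsAdmissible E E' Ω fun p => (T p, X p, U p)) (hp : p ∈ Ω) :
    ∂ᵤ X p = 0 := by
  by_contra hX
  have k : ∀ d : ℝ, d ≠ 0 → E.g p.1 * (∂ₓ X p * ∂ᵤ U p - ∂ᵤ X p * ∂ₓ U p) ^ 3 =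
      ∂ₜ T p * E'.g (T p) * d ^ 3 := by
    intro d hd
    have hd' : ∂ᵤ U p - (∂ᵤ U p - d) / ∂ᵤ X p * ∂ᵤ X p = d := by
      rw [div_mul_cancel₀ _ hX]
      ring
    have := h.g_mul_jacobian hp (b := (∂ᵤ U p - d) / ∂ᵤ X p) (by rwa [hd'])
    rwa [hd'] at this
  have h₁ := k 1 one_ne_zero
  have h₂ := k 2 two_ne_zero
  obtain ⟨hTx, hTu⟩ := h.partial_fst_eq_zero hp
  have : ∂ₜ T p * E'.g (T p) ≠ 0 :=
    mul_ne_zero (h.dirDeriv_fst_ne_zero hp hTx hTu) (h.target_g_ne_zero hp)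
  apply this
  linarith

theorem partial_ne_zero (h : IsAdmissible E E' Ω fun p => (T p, X p, U p)) (hp : p ∈ Ω) :
    ∂ₜ T p ≠ 0 ∧ ∂ₓ X p ≠ 0 ∧ ∂ᵤ U p ≠ 0 := by
  have hJ := h.jacobian_snd_ne_zero hp
  rw [h.partial_snd_eq_zero hp, zero_mul, sub_zero] at hJ
  obtain ⟨hTx, hTu⟩ := h.partial_fst_eq_zero hp
  exact ⟨h.dirDeriv_fst_ne_zero hp hTx hTu, left_ne_zero_of_mul hJ, right_ne_zero_of_mul hJ⟩

theorem g_eq (h : IsAdmissible E E' Ω fun p => (T p, X p, U p)) (hp : p ∈ Ω) :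
    E.g p.1 * ∂ₓ X p ^ 3 = ∂ₜ T p * E'.g (T p) := by
  obtain ⟨-, -, hU⟩ := h.partial_ne_zero hp
  have := h.g_mul_jacobian hp (b := 0) (by simpa using hU)
  rw [h.partial_snd_eq_zero hp] at this
  refine mul_right_cancel₀ (pow_ne_zero 3 hU) ?_
  linear_combination this

/-- Along a line on which `t` is constant, `T` and `T_t` are constant to the first order. -/
theorem hasDerivAt_line_fst (h : IsAdmissible E E' Ω fun p => (T p, X p, U p)) (hp : p ∈ Ω)
    (b c : ℝ) : (∀ᶠ s : ℝ in 𝓝 0, T (p + s • (0, b, c)) = T p) ∧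
      HasDerivAt (fun s : ℝ => ∂ₜ T (p + s • (0, b, c))) 0 0 := by
  have hΩ := h.isPointTransformation.isOpen
  have hT : ContDiffOn ℝ ∞ T Ω := h.isPointTransformation.smooth.fst
  have hz : ∀ q ∈ Ω, dirDeriv (0, b, c) T q = 0 := by
    intro q hq
    rw [dirDeriv, fderiv_apply_eq_partial, (h.partial_fst_eq_zero hq).1,
      (h.partial_fst_eq_zero hq).2]
    simp
  constructor
  · obtain ⟨ε, hε, hball⟩ := Metric.eventually_nhds_iff_ball.1
      (eventually_line_mem hΩ hp ((0, b, c) : ℝ × ℝ × ℝ))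
    have hd : ∀ s ∈ Metric.ball (0 : ℝ) ε,
        HasDerivAt (fun s : ℝ => T (p + s • (0, b, c))) 0 s := by
      intro s hs
      have hγ : HasDerivAt (fun s : ℝ => p + s • ((0, b, c) : ℝ × ℝ × ℝ)) (0, b, c) s := by
        simpa using ((hasDerivAt_id s).smul_const ((0, b, c) : ℝ × ℝ × ℝ)).const_add p
      refine (hasDerivAt_comp_path hΩ hT hγ (hball s hs)).congr_deriv ?_
      rw [← fderiv_apply_eq_partial]
      exact hz _ (hball s hs)
    filter_upwards [Metric.ball_mem_nhds (0 : ℝ) hε] with s hs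
    have := Metric.isOpen_ball.is_const_of_deriv_eq_zero (𝕜 := ℝ)
      (convex_ball (0 : ℝ) ε).isPreconnected
      (fun s hs => (hd s hs).differentiableAt.differentiableWithinAt)
      (fun s hs => (hd s hs).deriv) hs (Metric.mem_ball_self hε)
    simpa using this
  · have := hasDerivAt_line hΩ (contDiffOn_dirDeriv hΩ hT (1, 0, 0)) hp (0, b, c)
    rwa [dirDeriv_comm hΩ hT hp, dirDeriv_eq_zero hΩ hz hp] at this

/-- Every factor of `g_eq` other than `X_x` is constant to first order along the `x`-direction. -/
theorem partial_partial_snd_eq_zero (h : IsAdmissible E E' Ω fun p => (T p, X p, U p))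
    (hp : p ∈ Ω) : ∂ₓ (∂ₓ X) p = 0 := by
  have hΩ := h.isPointTransformation.isOpen
  have hX : ContDiffOn ℝ ∞ X Ω := h.isPointTransformation.smooth.snd.fst
  obtain ⟨hT, hTt⟩ := h.hasDerivAt_line_fst hp 1 0
  have hl := ((hasDerivAt_line hΩ (contDiffOn_dirDeriv hΩ hX (0, 1, 0)) hp (0, 1, 0)).fun_pow
    3).const_mul (E.g p.1)
  have hr := hTt.mul_const (E'.g (T p))
  have he : (fun s : ℝ => E.g p.1 * ∂ₓ X (p + s • (0, 1, 0)) ^ 3) =ᶠ[𝓝 0]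
      fun s : ℝ => ∂ₜ T (p + s • (0, 1, 0)) * E'.g (T p) := by
    filter_upwards [hT, eventually_line_mem hΩ hp ((0, 1, 0) : ℝ × ℝ × ℝ)] with s h₁ h₂
    have := h.g_eq h₂
    rw [h₁] at this
    simpa using this
  have := hl.unique (hr.congr_of_eventuallyEq he)
  simpa [h.source_g_ne_zero hp, (h.partial_ne_zero hp).2.1] using this

theorem curveDeriv_snd (h : IsAdmissible E E' Ω fun p => (T p, X p, U p)) (hp : p ∈ Ω)
    (φ₁ φ₂ φ₃ : ℝ) : curveDeriv₁ X p φ₁ = ∂ₓ X p ∧ curveDeriv₂ X p φ₁ φ₂ = 0 ∧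
      curveDeriv₃ X p φ₁ φ₂ φ₃ = 0 := by
  have hΩ := h.isPointTransformation.isOpen
  have hu : ∀ q ∈ Ω, ∂ᵤ X q = 0 := fun q hq => h.partial_snd_eq_zero hq
  have hxx : ∀ q ∈ Ω, ∂ₓ (∂ₓ X) q = 0 := fun q hq => h.partial_partial_snd_eq_zero hq
  have hxu : ∀ q ∈ Ω, ∂ₓ (∂ᵤ X) q = 0 := fun q hq => dirDeriv_eq_zero hΩ hu hq _
  have huu : ∀ q ∈ Ω, ∂ᵤ (∂ᵤ X) q = 0 := fun q hq => dirDeriv_eq_zero hΩ hu hq _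
  simp [curveDeriv₁, curveDeriv₂, curveDeriv₃, hu p hp, hxx p hp, hxu p hp, huu p hp,
    dirDeriv_eq_zero hΩ hxx hp, dirDeriv_eq_zero hΩ hxu hp, dirDeriv_eq_zero hΩ huu hp]

/-- The remaining part of the determining equations, with `u_x = φ₁` and `u_xx = φ₂` arbitrary. -/
theorem reduced_eq (h : IsAdmissible E E' Ω fun p => (T p, X p, U p)) (hp : p ∈ Ω)
    (φ₁ φ₂ b : ℝ) (hb : b * ∂ₓ X p = ∂ₓ U p + φ₁ * ∂ᵤ U p) :
    b * ∂ₜ X p - ∂ₜ U p - (E.k p.1 * p.2.2 + E.f p.1 * p.2.2 ^ 2) * (∂ₓ U p - b * ∂ₓ X p)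
      - E.g p.1 * curveDeriv₃ U p φ₁ φ₂ 0 =
      ∂ₜ T p * ((E'.k (T p) * U p + E'.f (T p) * U p ^ 2) * b) := by
  obtain ⟨-, hXx, hUu⟩ := h.partial_ne_zero hp
  have hXu := h.partial_snd_eq_zero hp
  -- With `X_u = X_xx = 0`, this value of `v_xx` produces the prescribed `u_xx = φ₂`; `v_xxx` is set
  -- to 0.
  obtain ⟨φ₁', φ₂', φ₃, e₁, e₂, e₃, hE⟩ := h.exists_reduced_jet hp b
    (curveDeriv₂ U p φ₁ φ₂ / ∂ₓ X p ^ 2) 0 (by simpa [hXu] using hUu)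
  obtain ⟨hX₁, hX₂, hX₃⟩ := h.curveDeriv_snd hp φ₁' φ₂' φ₃
  rw [hX₁] at e₁
  rw [hX₁, hX₂, div_mul_cancel₀ _ (pow_ne_zero 2 hXx)] at e₂
  rw [hX₁, hX₂, hX₃] at e₃
  rw [hXu] at hE
  obtain rfl : φ₁ = φ₁' := mul_right_cancel₀ hUu (by
    simp only [curveDeriv₁] at e₁
    linear_combination -hb - e₁)
  obtain rfl : φ₂ = φ₂' := mul_right_cancel₀ hUu (by
    simp only [curveDeriv₂] at e₂
    linear_combination - e₂)
  simp only [curveDeriv₃] at e₃ ⊢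
  linear_combination hE - E.g p.1 * e₃

/-- The coefficient of the free parameter `φ₂` in `reduced_eq` is, up to sign, `3 g (U_xu + φ₁
U_uu)`, and `φ₁` is free as well. -/
theorem partial_partial_thd_eq_zero (h : IsAdmissible E E' Ω fun p => (T p, X p, U p))
    (hp : p ∈ Ω) : ∂ₓ (∂ᵤ U) p = 0 ∧ ∂ᵤ (∂ᵤ U) p = 0 := by
  obtain ⟨-, hXx, hUu⟩ := h.partial_ne_zero hp
  have hg := h.source_g_ne_zero hp
  have k : ∀ φ₁ : ℝ, ∂ₓ (∂ᵤ U) p + φ₁ * ∂ᵤ (∂ᵤ U) p = 0 := by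
    intro φ₁
    have hb : (∂ₓ U p + φ₁ * ∂ᵤ U p) / ∂ₓ X p * ∂ₓ X p = ∂ₓ U p + φ₁ * ∂ᵤ U p :=
      div_mul_cancel₀ _ hXx
    have h₀ := h.reduced_eq hp φ₁ 0 _ hb
    have h₁ := h.reduced_eq hp φ₁ 1 _ hb
    simp only [curveDeriv₃] at h₀ h₁
    refine mul_left_cancel₀ hg ?_
    linear_combination (h₀ - h₁) / 3
  have h₀ := k 0
  have h₁ := k 1
  constructor <;> linarith

/-- With `U_xu = U_uu = 0` the third derivative no longer depends on `u_x`, so `reduced_eq` is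
affine in `b = v_x`. Its two coefficients vanish separately. -/
theorem affine_eq (h : IsAdmissible E E' Ω fun p => (T p, X p, U p)) (hp : p ∈ Ω) :
    ∂ₜ X p + (E.k p.1 * p.2.2 + E.f p.1 * p.2.2 ^ 2) * ∂ₓ X p =
        ∂ₜ T p * (E'.k (T p) * U p + E'.f (T p) * U p ^ 2) ∧
      ∂ₜ U p + (E.k p.1 * p.2.2 + E.f p.1 * p.2.2 ^ 2) * ∂ₓ U p
        + E.g p.1 * ∂ₓ (∂ₓ (∂ₓ U)) p = 0 := by
  have hΩ := h.isPointTransformation.isOpen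
  obtain ⟨-, hXx, hUu⟩ := h.partial_ne_zero hp
  have hxu : ∀ q ∈ Ω, ∂ₓ (∂ᵤ U) q = 0 := fun q hq => (h.partial_partial_thd_eq_zero hq).1
  have huu : ∀ q ∈ Ω, ∂ᵤ (∂ᵤ U) q = 0 := fun q hq => (h.partial_partial_thd_eq_zero hq).2
  have hU₃ : ∀ φ₁, curveDeriv₃ U p φ₁ 0 0 = ∂ₓ (∂ₓ (∂ₓ U)) p := by
    simp [curveDeriv₃, dirDeriv_eq_zero hΩ hxu hp, dirDeriv_eq_zero hΩ huu hp]
  have k : ∀ b : ℝ, b * ∂ₜ X p - ∂ₜ U p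
      - (E.k p.1 * p.2.2 + E.f p.1 * p.2.2 ^ 2) * (∂ₓ U p - b * ∂ₓ X p)
      - E.g p.1 * ∂ₓ (∂ₓ (∂ₓ U)) p =
      ∂ₜ T p * ((E'.k (T p) * U p + E'.f (T p) * U p ^ 2) * b) := by
    intro b
    -- This `u_x` realizes an arbitrary prescribed `v_x = b`; it exists because `U_u ≠ 0`.
    have := h.reduced_eq hp ((b * ∂ₓ X p - ∂ₓ U p) / ∂ᵤ U p) 0 b (by
      rw [div_mul_cancel₀ _ hUu]
      ring)
    rwa [hU₃] at this
  constructor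
  · linear_combination k 1 - k 0
  · linear_combination -k 0

end IsAdmissible

/-! ### Splitting the remaining identities in `x` and `u`; the constants of the transformation -/

namespace IsAdmissible

variable {E E' : GardnerEq} {Ω : Set (ℝ × ℝ × ℝ)} {T X U : ℝ × ℝ × ℝ → ℝ} {p : ℝ × ℝ × ℝ}

/-- The `x`- and `u`-derivatives of the first equation of `IsAdmissible.affine_eq`. -/
theorem affine_eq_deriv (h : IsAdmissible E E' Ω fun p => (T p, X p, U p)) (hp : p ∈ Ω) (b c : ℝ) :
    dirDeriv (0, b, c) (∂ₜ X) p + (E.k p.1 + 2 * E.f p.1 * p.2.2) * c * ∂ₓ X p =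
      ∂ₜ T p * (E'.k (T p) + 2 * E'.f (T p) * U p) * dirDeriv (0, b, c) U p := by
  have hΩ := h.isPointTransformation.isOpen
  have hX : ContDiffOn ℝ ∞ X Ω := h.isPointTransformation.smooth.snd.fst
  have hU : ContDiffOn ℝ ∞ U Ω := h.isPointTransformation.smooth.snd.snd
  obtain ⟨hT, hTt⟩ := h.hasDerivAt_line_fst hp b c
  have hXt := hasDerivAt_line hΩ (contDiffOn_dirDeriv hΩ hX (1, 0, 0)) hp (0, b, c)
  have hXx := hasDerivAt_line hΩ (contDiffOn_dirDeriv hΩ hX (0, 1, 0)) hp (0, b, c)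
  have hUl := hasDerivAt_line hΩ hU hp (0, b, c)
  have hu : HasDerivAt (fun s : ℝ => p.2.2 + s * c) c 0 := by
    simpa using ((hasDerivAt_id (0 : ℝ)).mul_const c).const_add p.2.2
  have hXx0 : dirDeriv (0, b, c) (∂ₓ X) p = 0 := by
    rw [dirDeriv, fderiv_apply_eq_partial, h.partial_partial_snd_eq_zero hp,
      dirDeriv_comm hΩ hX hp (0, 0, 1) (0, 1, 0),
      dirDeriv_eq_zero hΩ (fun q hq => h.partial_snd_eq_zero hq) hp (0, 1, 0)]
    simp
  have hl := hXt.add (((hu.const_mul (E.k p.1)).add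
    ((hu.fun_pow 2).const_mul (E.f p.1))).mul hXx)
  have hr := hTt.mul ((hUl.const_mul (E'.k (T p))).add ((hUl.fun_pow 2).const_mul (E'.f (T p))))
  have he : (fun s : ℝ => ∂ₜ X (p + s • (0, b, c)) + (E.k p.1 * (p.2.2 + s * c)
      + E.f p.1 * (p.2.2 + s * c) ^ 2) * ∂ₓ X (p + s • (0, b, c))) =ᶠ[𝓝 0]
      fun s : ℝ => ∂ₜ T (p + s • (0, b, c)) * (E'.k (T p) * U (p + s • (0, b, c))
        + E'.f (T p) * U (p + s • (0, b, c)) ^ 2) := by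
    filter_upwards [hT, eventually_line_mem hΩ hp ((0, b, c) : ℝ × ℝ × ℝ)] with s h₁ h₂
    have := (h.affine_eq h₂).1
    rw [h₁] at this
    simpa using this
  have := hl.unique (hr.congr_of_eventuallyEq he)
  simp only [hXx0, zero_mul, add_zero, zero_smul, mul_zero, zero_add] at this
  push_cast at this
  linear_combination this

theorem linear_eq (h : IsAdmissible E E' Ω fun p => (T p, X p, U p)) (hp : p ∈ Ω) :
    (E.k p.1 + 2 * E.f p.1 * p.2.2) * ∂ₓ X p =
      ∂ₜ T p * (E'.k (T p) + 2 * E'.f (T p) * U p) * ∂ᵤ U p := by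
  have hΩ := h.isPointTransformation.isOpen
  have hX : ContDiffOn ℝ ∞ X Ω := h.isPointTransformation.smooth.snd.fst
  have := h.affine_eq_deriv hp 0 1
  rw [dirDeriv_comm hΩ hX hp, dirDeriv_eq_zero hΩ (fun q hq => h.partial_snd_eq_zero hq) hp] at this
  linear_combination this

/-- The `x`- and `u`-derivatives of the equation of `IsAdmissible.linear_eq`. -/
theorem linear_eq_deriv (h : IsAdmissible E E' Ω fun p => (T p, X p, U p)) (hp : p ∈ Ω) (b c : ℝ) :
    E.f p.1 * c * ∂ₓ X p = ∂ₜ T p * E'.f (T p) * dirDeriv (0, b, c) U p * ∂ᵤ U p := by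
  have hΩ := h.isPointTransformation.isOpen
  have hX : ContDiffOn ℝ ∞ X Ω := h.isPointTransformation.smooth.snd.fst
  have hU : ContDiffOn ℝ ∞ U Ω := h.isPointTransformation.smooth.snd.snd
  obtain ⟨hT, hTt⟩ := h.hasDerivAt_line_fst hp b c
  have hXx := hasDerivAt_line hΩ (contDiffOn_dirDeriv hΩ hX (0, 1, 0)) hp (0, b, c)
  have hUl := hasDerivAt_line hΩ hU hp (0, b, c)
  have hUu := hasDerivAt_line hΩ (contDiffOn_dirDeriv hΩ hU (0, 0, 1)) hp (0, b, c)
  have hu : HasDerivAt (fun s : ℝ => p.2.2 + s * c) c 0 := by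
    simpa using ((hasDerivAt_id (0 : ℝ)).mul_const c).const_add p.2.2
  have hXx0 : dirDeriv (0, b, c) (∂ₓ X) p = 0 := by
    rw [dirDeriv, fderiv_apply_eq_partial, h.partial_partial_snd_eq_zero hp,
      dirDeriv_comm hΩ hX hp (0, 0, 1) (0, 1, 0),
      dirDeriv_eq_zero hΩ (fun q hq => h.partial_snd_eq_zero hq) hp (0, 1, 0)]
    simp
  have hUu0 : dirDeriv (0, b, c) (∂ᵤ U) p = 0 := by
    rw [dirDeriv, fderiv_apply_eq_partial, (h.partial_partial_thd_eq_zero hp).1,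
      (h.partial_partial_thd_eq_zero hp).2]
    simp
  have hl := ((hu.const_mul (2 * E.f p.1)).const_add (E.k p.1)).mul hXx
  have hr := (hTt.mul ((hUl.const_mul (2 * E'.f (T p))).const_add (E'.k (T p)))).mul hUu
  have he : (fun s : ℝ => (E.k p.1 + 2 * E.f p.1 * (p.2.2 + s * c)) * ∂ₓ X (p + s • (0, b, c)))
      =ᶠ[𝓝 0] fun s : ℝ => ∂ₜ T (p + s • (0, b, c)) * (E'.k (T p) + 2 * E'.f (T p)
        * U (p + s • (0, b, c))) * ∂ᵤ U (p + s • (0, b, c)) := by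
    filter_upwards [hT, eventually_line_mem hΩ hp ((0, b, c) : ℝ × ℝ × ℝ)] with s h₁ h₂
    have := h.linear_eq h₂
    rw [h₁] at this
    simpa using this
  have := hl.unique (hr.congr_of_eventuallyEq he)
  simp only [hXx0, hUu0, zero_mul, add_zero, zero_smul, mul_zero, zero_add] at this
  linear_combination this / 2

theorem f_eq (h : IsAdmissible E E' Ω fun p => (T p, X p, U p)) (hp : p ∈ Ω) :
    E.f p.1 * ∂ₓ X p = ∂ₜ T p * E'.f (T p) * ∂ᵤ U p ^ 2 := by
  linear_combination h.linear_eq_deriv hp 0 1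

/-- The `x`-direction of `linear_eq_deriv` reads `0 = T_t f' U_x U_u`, with `f'` the target
coefficient. Here its nonvanishing is decisive. Once `U_x` vanishes identically, the second part of
`affine_eq` reduces to `U_t = 0`. -/
theorem partial_thd_eq_zero (h : IsAdmissible E E' Ω fun p => (T p, X p, U p)) (hp : p ∈ Ω) :
    ∂ₜ U p = 0 ∧ ∂ₓ U p = 0 := by
  have hΩ := h.isPointTransformation.isOpen
  have hx : ∀ q ∈ Ω, ∂ₓ U q = 0 := by
    intro q hq
    obtain ⟨hTt, -, hUu⟩ := h.partial_ne_zero hq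
    simpa [hTt, hUu, h.target_f_ne_zero hq] using h.linear_eq_deriv hq 1 0
  have hxx : ∀ q ∈ Ω, ∂ₓ (∂ₓ U) q = 0 := fun q hq => dirDeriv_eq_zero hΩ hx hq _
  have := (h.affine_eq hp).2
  rw [hx p hp, dirDeriv_eq_zero hΩ hxx hp] at this
  exact ⟨by linear_combination this, hx p hp⟩

theorem exists_const (h : IsAdmissible E E' Ω fun p => (T p, X p, U p)) :
    ∃ δ₁ δ₂ δ₃ : ℝ, δ₁ * δ₂ ≠ 0 ∧ ∀ p ∈ Ω, ∂ₓ X p = δ₁ ∧ ∂ᵤ U p = δ₂ ∧ U p = δ₂ * p.2.2 + δ₃ := by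
  have hΩ := h.isPointTransformation.isOpen
  have hc := h.isPointTransformation.isConnected
  have hX : ContDiffOn ℝ ∞ X Ω := h.isPointTransformation.smooth.snd.fst
  have hU : ContDiffOn ℝ ∞ U Ω := h.isPointTransformation.smooth.snd.snd
  have hXx := contDiffOn_dirDeriv hΩ hX (0, 1, 0)
  have hUu := contDiffOn_dirDeriv hΩ hU (0, 0, 1)
  obtain ⟨δ₁, h₁⟩ : ∃ δ₁, ∀ p ∈ Ω, ∂ₓ X p = δ₁ := by
    refine exists_eq_of_partial_eq_zero hΩ hc (hXx.differentiableOn (by simp)) fun q hq =>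
      ⟨?_, h.partial_partial_snd_eq_zero hq, ?_⟩
    · rw [dirDeriv_comm hΩ hX hq]
      -- In the `x`-direction the right side contains the factor `U_x = 0`, which leaves `X_tx = 0`.
      have := h.affine_eq_deriv hq 1 0
      rw [(h.partial_thd_eq_zero hq).2] at this
      linear_combination this
    · rw [dirDeriv_comm hΩ hX hq, dirDeriv_eq_zero hΩ (fun q hq => h.partial_snd_eq_zero hq) hq]
  obtain ⟨δ₂, h₂⟩ : ∃ δ₂, ∀ p ∈ Ω, ∂ᵤ U p = δ₂ := by
    refine exists_eq_of_partial_eq_zero hΩ hc (hUu.differentiableOn (by simp)) fun q hq =>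
      ⟨?_, h.partial_partial_thd_eq_zero hq⟩
    rw [dirDeriv_comm hΩ hU hq, dirDeriv_eq_zero hΩ (fun q hq => (h.partial_thd_eq_zero hq).1) hq]
  obtain ⟨δ₃, h₃⟩ : ∃ δ₃, ∀ p ∈ Ω, U p - δ₂ * p.2.2 = δ₃ := by
    refine exists_eq_of_hasFDerivAt_zero hΩ hc fun q hq => ?_
    refine ((hasFDerivAt_of_contDiffOn_isOpen hΩ hU hq).sub
      (hasFDerivAt_snd.snd.const_mul δ₂)).congr_fderiv (ContinuousLinearMap.ext fun w => ?_)
    simp [fderiv_apply_eq_partial, h₂ q hq, h.partial_thd_eq_zero hq]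
    ring
  obtain ⟨p, hp⟩ := hc.nonempty
  refine ⟨δ₁, δ₂, δ₃, ?_, fun p hp => ⟨h₁ p hp, h₂ p hp, by linear_combination h₃ p hp⟩⟩
  rw [← h₁ p hp, ← h₂ p hp]
  exact mul_ne_zero (h.partial_ne_zero hp).2.1 (h.partial_ne_zero hp).2.2

end IsAdmissible

/-! ### Functions on open intervals -/

theorem exists_hasDerivAt_of_continuousOn {s : Set ℝ} (hs : IsOpen s) (hc : IsConnected s)
    {f : ℝ → ℝ} (hf : ContinuousOn f s) : ∃ H : ℝ → ℝ, ∀ t ∈ s, HasDerivAt H (f t) t := by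
  obtain ⟨a, ha⟩ := hc.nonempty
  have hoc := hc.isPreconnected.ordConnected
  refine ⟨fun t => ∫ r in a..t, f r, fun t ht => ?_⟩
  exact intervalIntegral.integral_hasDerivAt_right
    ((hf.mono (hoc.uIcc_subset ha ht)).intervalIntegrable)
    (hf.stronglyMeasurableAtFilter hs t ht) (hf.continuousAt (hs.mem_nhds ht))

theorem injOn_of_hasDerivAt_ne_zero {s : Set ℝ} (hc : IsConnected s) {f f' : ℝ → ℝ}
    (hf : ∀ t ∈ s, HasDerivAt f (f' t) t) (h0 : ∀ t ∈ s, f' t ≠ 0) : InjOn f s := by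
  have hoc := hc.isPreconnected.ordConnected
  have key : ∀ a ∈ s, ∀ b ∈ s, a < b → f a ≠ f b := by
    intro a ha b hb hab he
    have hsub := hoc.out ha hb
    obtain ⟨t, ht, h⟩ := exists_hasDerivAt_eq_zero hab
      (fun t ht => (hf t (hsub ht)).continuousAt.continuousWithinAt) he
      fun t ht => hf t (hsub (Ioo_subset_Icc_self ht))
    exact h0 t (hsub (Ioo_subset_Icc_self ht)) h
  intro a ha b hb he
  rcases lt_trichotomy a b with hlt | heq | hgt
  · exact absurd he (key a ha b hb hlt)
  · exact heq
  · exact absurd he.symm (key b hb a ha hgt)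

/-! ### Global dependence of the new time on the old one -/

namespace IsAdmissible

variable {E E' : GardnerEq} {Ω : Set (ℝ × ℝ × ℝ)} {T X U : ℝ × ℝ × ℝ → ℝ}

/-- The new time depends on the old one only, also if the fibres of `Ω` over the time axis are not
connected. -/
theorem fst_eq_of_fst_eq (h : IsAdmissible E E' Ω fun p => (T p, X p, U p)) {p q : ℝ × ℝ × ℝ}
    (hp : p ∈ Ω) (hq : q ∈ Ω) (hpq : p.1 = q.1) : T p = T q := by
  have hΩ := h.isPointTransformation.isOpen
  have hc := h.isPointTransformation.isConnected
  have hT : ContDiffOn ℝ ∞ T Ω := h.isPointTransformation.smooth.fst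
  obtain ⟨δ₁, δ₂, δ₃, -, hδ⟩ := h.exists_const
  obtain ⟨G, hG⟩ := exists_hasDerivAt_of_continuousOn E.isOpen_dom E.isConnected_dom
    E.smooth_g.continuousOn
  obtain ⟨G', hG'⟩ := exists_hasDerivAt_of_continuousOn E'.isOpen_dom E'.isConnected_dom
    E'.smooth_g.continuousOn
  -- Integrating `g_eq` in time, with antiderivatives `G` and `G'` of the two dispersion
  -- coefficients, gives `G'(T) - δ₁ ^ 3 G(t)` constant on all of the connected set `Ω`. Since `G'`
  -- is injective, `t` determines `T` even across different components of a fibre.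
  have hd : ∀ r ∈ Ω, HasFDerivAt (fun r : ℝ × ℝ × ℝ => G' (T r) - δ₁ ^ 3 * G r.1)
      (0 : ℝ × ℝ × ℝ →L[ℝ] ℝ) r := by
    intro r hr
    have h₁ := (hG' _ (h.target_mem r hr)).comp_hasFDerivAt r
      (hasFDerivAt_of_contDiffOn_isOpen hΩ hT hr)
    have h₂ := ((hG _ (h.source_mem r hr)).comp_hasFDerivAt r (hasFDerivAt_fst (𝕜 := ℝ))).const_mul (δ₁ ^ 3)
    refine (h₁.sub h₂).congr_fderiv (ContinuousLinearMap.ext fun w => ?_)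
    have hg := h.g_eq hr
    rw [(hδ r hr).1] at hg
    simp [fderiv_apply_eq_partial, h.partial_fst_eq_zero hr]
    linear_combination -w.1 * hg
  obtain ⟨C, hC⟩ := exists_eq_of_hasFDerivAt_zero hΩ hc hd
  have he := (hC p hp).trans (hC q hq).symm
  refine injOn_of_hasDerivAt_ne_zero E'.isConnected_dom hG'
    (fun t ht => right_ne_zero_of_mul (E'.fg_ne_zero t ht)) (h.target_mem p hp) (h.target_mem q hq) ?_
  simp only [hpq] at he
  linarith

end IsAdmissible

/-! ### Transformations of the form prescribed by the group -/

/-- An unbundled form of the data of an induced transformation, with the additive constant absorbed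
into the antiderivative `h` and with denominators cleared. -/
structure InducedData (E E' : GardnerEq) (Ω : Set (ℝ × ℝ × ℝ)) (Φ : ℝ × ℝ × ℝ → ℝ × ℝ × ℝ)
    (D : Set ℝ) (α α' h : ℝ → ℝ) (δ₁ δ₂ δ₃ : ℝ) : Prop where
  isOpen : IsOpen D
  isConnected : IsConnected D
  smooth : ContDiffOn ℝ ∞ α D
  hasDerivAt : ∀ t ∈ D, HasDerivAt α (α' t) t
  ne_zero : ∀ t ∈ D, α' t ≠ 0
  δ₁_ne_zero : δ₁ ≠ 0
  δ₂_ne_zero : δ₂ ≠ 0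
  source_subset : D ⊆ E.dom
  target_mem : ∀ t ∈ D, α t ∈ E'.dom
  k_eq : ∀ t ∈ D, E'.k (α t) * (δ₂ ^ 2 * α' t) = δ₁ * (δ₂ * E.k t - 2 * δ₃ * E.f t)
  f_eq : ∀ t ∈ D, E'.f (α t) * (δ₂ ^ 2 * α' t) = δ₁ * E.f t
  g_eq : ∀ t ∈ D, E'.g (α t) * α' t = δ₁ ^ 3 * E.g t
  shift_hasDerivAt : ∀ t ∈ D,
    HasDerivAt h (δ₁ * δ₃ / δ₂ ^ 2 * (δ₂ * E.k t - δ₃ * E.f t)) t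
  fst_mem : ∀ p ∈ Ω, p.1 ∈ D
  map_eq : ∀ p ∈ Ω, Φ p = (α p.1, δ₁ * p.2.1 + h p.1, δ₂ * p.2.2 + δ₃)

theorem GardnerEq.exists_antideriv (E : GardnerEq) {D : Set ℝ} (hD : IsOpen D)
    (hc : IsConnected D) (hE : D ⊆ E.dom) (a b : ℝ) :
    ∃ H : ℝ → ℝ, ∀ t ∈ D, HasDerivAt H (a * E.k t - b * E.f t) t :=
  exists_hasDerivAt_of_continuousOn hD hc
    (((E.smooth_k.continuousOn.mono hE).const_smul a).sub
      ((E.smooth_f.continuousOn.mono hE).const_smul b))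

theorem GHat.inducedData {e : GHat} {E E' : GardnerEq} {Ω : Set (ℝ × ℝ × ℝ)}
    {Φ : ℝ × ℝ × ℝ → ℝ × ℝ × ℝ} (hc : e.MapsCoeffs E E') (hv : e.MapsVariables E Ω Φ) :
    ∃ h, InducedData E E' Ω Φ e.dom e.α (deriv e.α) h e.δ₁ e.δ₂ e.δ₃ := by
  obtain ⟨H, hH, hΦ⟩ := hv
  have hδ₁ := left_ne_zero_of_mul e.δ_ne_zero
  have hδ₂ := right_ne_zero_of_mul e.δ_ne_zero
  refine ⟨fun t => e.δ₁ * e.δ₃ / e.δ₂ ^ 2 * H t + e.δ₄, e.isOpen_dom, e.isConnected_dom,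
    e.smooth_α, fun t ht => ?_, e.deriv_α_ne_zero, hδ₁, hδ₂, hc.source_subset,
    fun t ht => hc.target_subset ⟨t, ht, rfl⟩, fun t ht => ?_, fun t ht => ?_, fun t ht => ?_,
    fun t ht => ((hH t ht).const_mul _).add_const _, fun p hp => (hΦ p hp).1, fun p hp => ?_⟩
  · exact ((e.smooth_α.contDiffAt (e.isOpen_dom.mem_nhds ht)).differentiableAt
      (by simp)).hasDerivAt
  · have := e.deriv_α_ne_zero t ht
    rw [hc.k_eq t ht]
    field_simp
  · have := e.deriv_α_ne_zero t ht
    rw [hc.f_eq t ht]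
    field_simp
  · have := e.deriv_α_ne_zero t ht
    rw [hc.g_eq t ht]
    field_simp
  · rw [(hΦ p hp).2, add_assoc]

theorem IsInduced.exists_inducedData {E E' : GardnerEq} {Ω : Set (ℝ × ℝ × ℝ)}
    {Φ : ℝ × ℝ × ℝ → ℝ × ℝ × ℝ} (hI : IsInduced E E' Ω Φ) :
    ∃ D α α' h δ₁ δ₂ δ₃, InducedData E E' Ω Φ D α α' h δ₁ δ₂ δ₃ := by
  obtain ⟨-, -, e, hc, hv⟩ := hI
  obtain ⟨h, hd⟩ := GHat.inducedData hc hv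
  exact ⟨_, _, _, h, _, _, _, hd⟩

/-! ### Inverse functions on intervals -/

theorem exists_smooth_inverse {D : Set ℝ} (hD : IsOpen D) (hc : IsConnected D) {α α' : ℝ → ℝ}
    (hs : ContDiffOn ℝ ∞ α D) (hα : ∀ t ∈ D, HasDerivAt α (α' t) t) (h0 : ∀ t ∈ D, α' t ≠ 0) :
    IsOpen (α '' D) ∧ IsConnected (α '' D) ∧ ∃ β : ℝ → ℝ, (∀ t ∈ D, β (α t) = t) ∧
      ContDiffOn ℝ ∞ β (α '' D) ∧ ∀ t ∈ D, HasDerivAt β (α' t)⁻¹ (α t) := by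
  have hinj : InjOn α D := injOn_of_hasDerivAt_ne_zero hc hα h0
  have hβ : ∀ t ∈ D, Function.invFunOn α D (α t) = t := fun t ht =>
    hinj.leftInvOn_invFunOn ht
  have hst : ∀ t ∈ D, HasStrictDerivAt α (α' t) t := fun t ht =>
    (hs.contDiffAt (hD.mem_nhds ht)).hasStrictDerivAt' (hα t ht) (by simp)
  have hβs : ∀ t ∈ D, ContDiffAt ℝ ∞ (Function.invFunOn α D) (α t) := by
    intro t ht
    have hat := hs.contDiffAt (hD.mem_nhds ht)
    have hd : HasFDerivAt α (ContinuousLinearEquiv.unitsEquivAut ℝ (Units.mk0 (α' t) (h0 t ht)) :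
        ℝ →L[ℝ] ℝ) t := by
      refine (hα t ht).hasFDerivAt.congr_fderiv ?_
      ext
      simp
    have hl := hat.to_localInverse hd (by simp)
    -- Smoothness is taken from the local inverse, which agrees with the global one near `α t`: it
    -- maps nearby points into `D`, where `α` is injective.
    refine hl.congr_of_eventuallyEq ?_
    have hr := (hat.hasStrictFDerivAt' hd (by simp)).eventually_right_inverse
    have hm : ∀ᶠ y in 𝓝 (α t), hat.localInverse hd (by simp) y ∈ D := by
      refine hl.continuousAt.eventually_mem ?_
      rw [hat.localInverse_apply_image hd (by simp)]
      exact hD.mem_nhds ht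
    filter_upwards [hr, hm] with y h₁ h₂
    have := hβ _ h₂
    rwa [show α (hat.localInverse hd (by simp) y) = y from h₁] at this
  refine ⟨?_, hc.image α hs.continuousOn, Function.invFunOn α D, hβ, ?_, fun t ht => ?_⟩
  · rw [isOpen_iff_mem_nhds]
    rintro _ ⟨t, ht, rfl⟩
    rw [← (hst t ht).map_nhds_eq (h0 t ht)]
    exact image_mem_map (hD.mem_nhds ht)
  · rintro _ ⟨t, ht, rfl⟩
    exact (hβs t ht).contDiffWithinAt
  · have hd := ((hβs t ht).differentiableAt (by simp)).hasDerivAt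
    have he : (fun s => Function.invFunOn α D (α s)) =ᶠ[𝓝 t] fun s => s := by
      filter_upwards [hD.mem_nhds ht] with s hs using hβ s hs
    have hu := (hd.comp t (hα t ht)).unique ((hasDerivAt_id t).congr_of_eventuallyEq he)
    rwa [eq_inv_of_mul_eq_one_left hu] at hd

/-! ### Induced transformations are admissible -/

theorem HasJetAt.comp_affine {y : ℝ → ℝ} {a b x y₀ y₁ y₂ y₃ : ℝ}
    (h : HasJetAt y (a * x + b) y₀ y₁ y₂ y₃) :
    HasJetAt (fun s => y (a * s + b)) x y₀ (a * y₁) (a ^ 2 * y₂) (a ^ 3 * y₃) := by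
  obtain ⟨y', y'', rfl, rfl, rfl, hy, hy', hy''⟩ := h
  have hl : ∀ s, HasDerivAt (fun s => a * s + b) a s := fun s => by
    simpa using ((hasDerivAt_id s).const_mul a).add_const b
  have ht : Tendsto (fun s => a * s + b) (𝓝 x) (𝓝 (a * x + b)) := (hl x).continuousAt
  refine ⟨fun s => a * y' (a * s + b), fun s => a ^ 2 * y'' (a * s + b), rfl, rfl, rfl, ?_, ?_, ?_⟩
  · filter_upwards [ht.eventually hy] with s hs
    exact (hs.comp s (hl s)).congr_deriv (by ring)
  · filter_upwards [ht.eventually hy'] with s hs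
    exact ((hs.comp s (hl s)).const_mul a).congr_deriv (by ring)
  · exact ((HasDerivAt.comp x hy'' (hl x)).const_mul (a ^ 2)).congr_deriv (by ring)

theorem det_ne_zero_of_injective {L : ℝ × ℝ × ℝ →L[ℝ] ℝ × ℝ × ℝ} (h : ∀ w, L w = 0 → w = 0) :
    L.det ≠ 0 := by
  intro h0
  have := LinearMap.bot_lt_ker_of_det_eq_zero (f := (L : ℝ × ℝ × ℝ →ₗ[ℝ] ℝ × ℝ × ℝ)) h0
  refine this.ne' ?_
  rw [LinearMap.ker_eq_bot']
  exact h

namespace InducedData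

variable {E E' E'' : GardnerEq} {Ω Ω' : Set (ℝ × ℝ × ℝ)} {Φ Φ' : ℝ × ℝ × ℝ → ℝ × ℝ × ℝ}
  {D D' : Set ℝ} {α α' h β β' h' : ℝ → ℝ} {δ₁ δ₂ δ₃ ε₁ ε₂ ε₃ : ℝ}

theorem isInduced (d : InducedData E E' Ω Φ D α α' h δ₁ δ₂ δ₃) (hΩ : IsOpen Ω)
    (hc : IsConnected Ω) : IsInduced E E' Ω Φ := by
  have hδ₁ := d.δ₁_ne_zero
  have hδ₂ := d.δ₂_ne_zero
  obtain ⟨H, hH⟩ := E.exists_antideriv d.isOpen d.isConnected d.source_subset δ₂ δ₃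
  -- The constant `δ₄` is recovered as the difference of two antiderivatives on the interval `D`.
  obtain ⟨δ₄, hδ₄⟩ : ∃ δ₄, ∀ t ∈ D, h t - δ₁ * δ₃ / δ₂ ^ 2 * H t = δ₄ := by
    have hd : ∀ t ∈ D, HasDerivAt (fun t => h t - δ₁ * δ₃ / δ₂ ^ 2 * H t) 0 t := fun t ht =>
      ((d.shift_hasDerivAt t ht).sub ((hH t ht).const_mul _)).congr_deriv (sub_self _)
    exact d.isOpen.exists_is_const_of_deriv_eq_zero d.isConnected.isPreconnected
      (fun t ht => (hd t ht).differentiableAt.differentiableWithinAt) fun t ht => (hd t ht).deriv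
  have hα : ∀ t ∈ D, deriv α t = α' t := fun t ht => (d.hasDerivAt t ht).deriv
  refine ⟨hΩ, hc, ⟨D, d.isOpen, d.isConnected, α, d.smooth,
    fun t ht => (hα t ht).symm ▸ d.ne_zero t ht, δ₁, δ₂, δ₃, δ₄, mul_ne_zero hδ₁ hδ₂⟩,
    ⟨d.source_subset, ?_, fun t ht => ?_, fun t ht => ?_, fun t ht => ?_⟩, H, hH, fun p hp =>
    ⟨d.fst_mem p hp, ?_⟩⟩
  · rintro _ ⟨t, ht, rfl⟩
    exact d.target_mem t ht
  · have h0 := d.ne_zero t ht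
    have := d.k_eq t ht
    simp only [hα t ht]
    field_simp
    linear_combination this
  · have h0 := d.ne_zero t ht
    have := d.f_eq t ht
    simp only [hα t ht]
    field_simp
    linear_combination this
  · have h0 := d.ne_zero t ht
    have := d.g_eq t ht
    simp only [hα t ht]
    field_simp
    linear_combination this
  · simp only [d.map_eq p hp, Prod.mk.injEq, true_and, and_true]
    linear_combination hδ₄ _ (d.fst_mem p hp)

theorem contDiffOn_shift (d : InducedData E E' Ω Φ D α α' h δ₁ δ₂ δ₃) : ContDiffOn ℝ ∞ h D := by
  rw [contDiffOn_infty_iff_deriv_of_isOpen d.isOpen]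
  refine ⟨fun t ht => (d.shift_hasDerivAt t ht).differentiableAt.differentiableWithinAt, ?_⟩
  refine ContDiffOn.congr (f := fun t => δ₁ * δ₃ / δ₂ ^ 2 * (δ₂ * E.k t - δ₃ * E.f t)) ?_
    fun t ht => (d.shift_hasDerivAt t ht).deriv
  exact contDiffOn_const.mul ((contDiffOn_const.mul (E.smooth_k.mono d.source_subset)).sub
    (contDiffOn_const.mul (E.smooth_f.mono d.source_subset)))

theorem contDiffOn (d : InducedData E E' Ω Φ D α α' h δ₁ δ₂ δ₃) : ContDiffOn ℝ ∞ Φ Ω := by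
  refine ContDiffOn.congr ?_ d.map_eq
  have hm : MapsTo Prod.fst Ω D := d.fst_mem
  exact (d.smooth.comp contDiffOn_fst hm).prodMk
    (((contDiffOn_const.mul contDiff_snd.fst.contDiffOn).add
      (d.contDiffOn_shift.comp contDiffOn_fst hm)).prodMk
      ((contDiffOn_const.mul contDiff_snd.snd.contDiffOn).add contDiffOn_const))

theorem isPointTransformation (d : InducedData E E' Ω Φ D α α' h δ₁ δ₂ δ₃) (hΩ : IsOpen Ω)
    (hc : IsConnected Ω) : IsPointTransformation Ω Φ := by
  refine ⟨hΩ, hc, d.contDiffOn, fun p hp => det_ne_zero_of_injective fun w hw => ?_⟩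
  have hp' := d.fst_mem p hp
  have he : Φ =ᶠ[𝓝 p] fun p => (α p.1, δ₁ * p.2.1 + h p.1, δ₂ * p.2.2 + δ₃) := by
    filter_upwards [hΩ.mem_nhds hp] with q hq using d.map_eq q hq
  have h₁ := (d.hasDerivAt _ hp').comp_hasFDerivAt p (hasFDerivAt_fst (𝕜 := ℝ))
  have h₂ := ((hasFDerivAt_snd (𝕜 := ℝ) (p := p)).fst.const_mul δ₁).add
    ((d.shift_hasDerivAt _ hp').comp_hasFDerivAt p (hasFDerivAt_fst (𝕜 := ℝ)))
  have h₃ := ((hasFDerivAt_snd (𝕜 := ℝ) (p := p)).snd.const_mul δ₂).add_const δ₃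
  have hd := (h₁.prodMk (h₂.prodMk h₃)).congr_of_eventuallyEq he
  rw [hd.fderiv] at hw
  obtain ⟨a, b, c⟩ := w
  simp only [ContinuousLinearMap.prod_apply, Prod.mk_eq_zero] at hw
  obtain ⟨e₁, e₂, e₃⟩ := hw
  have ha : a = 0 := by simpa [d.ne_zero _ hp'] using e₁
  subst ha
  have hb : b = 0 := by simpa [d.δ₁_ne_zero] using e₂
  have hc : c = 0 := by simpa [d.δ₂_ne_zero] using e₃
  simp [hb, hc]

theorem holds_iff (d : InducedData E E' Ω Φ D α α' h δ₁ δ₂ δ₃) (hΩ : IsOpen Ω) {t x : ℝ}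
    {u v : ℝ → ℝ → ℝ} (hp : (t, x, u t x) ∈ Ω)
    (hu : ContDiffAt ℝ ∞ (fun q : ℝ × ℝ => u q.1 q.2) (t, x))
    (hv : ContDiffAt ℝ ∞ (fun q : ℝ × ℝ => v q.1 q.2) (α t, δ₁ * x + h t))
    (hm : MapsGraphAt Φ u v t x) : E.HoldsAt u t x ↔ E'.HoldsAt v (α t) (δ₁ * x + h t) := by
  have hδ₂ := d.δ₂_ne_zero
  have ht : t ∈ D := d.fst_mem _ hp
  have hev : ∀ᶠ q : ℝ × ℝ in 𝓝 (t, x),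
      u q.1 q.2 = δ₂⁻¹ * (v (α q.1) (δ₁ * q.2 + h q.1) + -δ₃) := by
    have hcont : ContinuousAt (fun q : ℝ × ℝ => (q.1, q.2, u q.1 q.2)) (t, x) :=
      continuousAt_fst.prodMk (continuousAt_snd.prodMk hu.continuousAt)
    filter_upwards [hm, hcont.eventually_mem (hΩ.mem_nhds hp)] with q h₁ h₂
    rw [d.map_eq _ h₂] at h₁
    simp only at h₁
    rw [h₁]
    field_simp
    ring
  have evx : u t =ᶠ[𝓝 x] fun s => δ₂⁻¹ * (v (α t) (δ₁ * s + h t) + -δ₃) :=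
    (show Tendsto (fun s => (t, s)) (𝓝 x) (𝓝 (t, x)) from
      Continuous.tendsto (by fun_prop) x).eventually hev
  have evt : (fun s => u s x) =ᶠ[𝓝 t] fun s => δ₂⁻¹ * (v (α s) (δ₁ * x + h s) + -δ₃) :=
    (show Tendsto (fun s => (s, x)) (𝓝 t) (𝓝 (t, x)) from
      Continuous.tendsto (by fun_prop) t).eventually hev
  have hvx : ContDiffAt ℝ ∞ (v (α t)) (δ₁ * x + h t) :=
    ContDiffAt.comp (δ₁ * x + h t) (g := fun q : ℝ × ℝ => v q.1 q.2) (f := fun s => (α t, s)) hv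
      (by fun_prop)
  have hj := ((HasJetAt.const δ₂⁻¹ x).mul
    ((HasJetAt.of_contDiffAt hvx).comp_affine.add (.const (-δ₃) x))).congr evx
  have hvd := (hv.differentiableAt (by simp)).hasFDerivAt
  set L := fderiv ℝ (fun q : ℝ × ℝ => v q.1 q.2) (α t, δ₁ * x + h t) with hL
  have hvt : HasDerivAt (fun s => v s (δ₁ * x + h t)) (L (1, 0)) (α t) :=
    HasFDerivAt.comp_hasDerivAt (f := fun s => (s, δ₁ * x + h t)) (α t) hvd
      ((hasDerivAt_id (α t)).prodMk (hasDerivAt_const (α t) (δ₁ * x + h t)))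
  have hvx' : HasDerivAt (v (α t)) (L (0, 1)) (δ₁ * x + h t) :=
    hvd.comp_hasDerivAt (δ₁ * x + h t)
      ((hasDerivAt_const (δ₁ * x + h t) (α t)).prodMk (hasDerivAt_id (δ₁ * x + h t)))
  have hut := (((hvd.comp_hasDerivAt t ((d.hasDerivAt t ht).prodMk
    ((d.shift_hasDerivAt t ht).const_add (δ₁ * x)))).add_const (-δ₃)).const_mul
      δ₂⁻¹).congr_of_eventuallyEq evt
  have hsplit : ∀ a b : ℝ, L (a, b) = a * L (1, 0) + b * L (0, 1) := by
    intro a b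
    have : ((a, b) : ℝ × ℝ) = a • (1, 0) + b • (0, 1) := by simp
    rw [this, map_add, map_smul, map_smul, smul_eq_mul, smul_eq_mul]
  -- The shift of `x` absorbs the term linear in `v_x` that the translation of `u` by `δ₃` creates
  -- in the nonlinearities.
  have key : α' t * (deriv (fun s => v s (δ₁ * x + h t)) (α t)
      + E'.k (α t) * v (α t) (δ₁ * x + h t) * deriv (v (α t)) (δ₁ * x + h t)
      + E'.f (α t) * v (α t) (δ₁ * x + h t) ^ 2 * deriv (v (α t)) (δ₁ * x + h t)
      + E'.g (α t) * iteratedDeriv 3 (v (α t)) (δ₁ * x + h t)) =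
      δ₂ * (deriv (fun s => u s x) t + E.k t * u t x * deriv (u t) x
        + E.f t * u t x ^ 2 * deriv (u t) x + E.g t * iteratedDeriv 3 (u t) x) := by
    have e₀ : v (α t) (δ₁ * x + h t) = δ₂ * u t x + δ₃ := by
      rw [hj.eq_value]
      field_simp
      ring
    rw [hut.deriv, hsplit, hj.hasDerivAt.deriv, hj.iteratedDeriv_three, hvt.deriv, hvx'.deriv, e₀]
    have hk := d.k_eq t ht
    have hf := d.f_eq t ht
    have hg := d.g_eq t ht
    field_simp
    linear_combination (δ₂ * u t x + δ₃) * L (0, 1) * hk + (δ₂ * u t x + δ₃) ^ 2 * L (0, 1) * hf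
      + δ₂ ^ 2 * iteratedDeriv 3 (v (α t)) (δ₁ * x + h t) * hg
  unfold GardnerEq.HoldsAt
  constructor
  · intro h0
    rw [h0, mul_zero] at key
    exact (mul_eq_zero.1 key).resolve_left (d.ne_zero t ht)
  · intro h0
    rw [h0, mul_zero] at key
    exact (mul_eq_zero.1 key.symm).resolve_left hδ₂

theorem isAdmissible (d : InducedData E E' Ω Φ D α α' h δ₁ δ₂ δ₃) (hΩ : IsOpen Ω)
    (hc : IsConnected Ω) : IsAdmissible E E' Ω Φ := by
  refine ⟨d.isPointTransformation hΩ hc, fun p hp => d.source_subset (d.fst_mem p hp),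
    fun p hp => ?_, fun t x u v hp hu hv hm => ?_⟩
  · rw [d.map_eq p hp]
    exact d.target_mem _ (d.fst_mem p hp)
  · rw [d.map_eq _ hp] at hv ⊢
    exact d.holds_iff hΩ hp hu hv hm

/-! ### Composition and inversion -/

/-- The time interval is cut down to the projection of `Ω`, because `α` need not map all of `D` into
`D'`. -/
theorem comp (d : InducedData E E' Ω Φ D α α' h δ₁ δ₂ δ₃)
    (d' : InducedData E' E'' Ω' Φ' D' β β' h' ε₁ ε₂ ε₃) (hΩ : IsOpen Ω) (hc : IsConnected Ω)
    (hm : MapsTo Φ Ω Ω') :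
    InducedData E E'' Ω (Φ' ∘ Φ) (Prod.fst '' Ω) (β ∘ α) (fun t => β' (α t) * α' t)
      (fun t => ε₁ * h t + h' (α t)) (ε₁ * δ₁) (ε₂ * δ₂) (ε₂ * δ₃ + ε₃) := by
  have hD : Prod.fst '' Ω ⊆ D := by
    rintro _ ⟨p, hp, rfl⟩
    exact d.fst_mem p hp
  have hD' : ∀ t ∈ Prod.fst '' Ω, α t ∈ D' := by
    rintro _ ⟨p, hp, rfl⟩
    have := d'.fst_mem _ (hm hp)
    rwa [d.map_eq p hp] at this
  have hδ₂ := d.δ₂_ne_zero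
  have hε₂ := d'.δ₂_ne_zero
  refine ⟨isOpenMap_fst Ω hΩ, hc.image _ continuous_fst.continuousOn,
    d'.smooth.comp (d.smooth.mono hD) hD',
    fun t ht => (d'.hasDerivAt _ (hD' t ht)).comp t (d.hasDerivAt t (hD ht)),
    fun t ht => mul_ne_zero (d'.ne_zero _ (hD' t ht)) (d.ne_zero t (hD ht)),
    mul_ne_zero d'.δ₁_ne_zero d.δ₁_ne_zero, mul_ne_zero hε₂ hδ₂, hD.trans d.source_subset,
    fun t ht => d'.target_mem _ (hD' t ht), fun t ht => ?_, fun t ht => ?_, fun t ht => ?_,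
    fun t ht => ?_, fun p hp => ⟨p, hp, rfl⟩, fun p hp => ?_⟩
  · have hk := d.k_eq t (hD ht)
    have hf := d.f_eq t (hD ht)
    have hk' := d'.k_eq _ (hD' t ht)
    simp only [Function.comp_apply]
    linear_combination δ₂ ^ 2 * α' t * hk' + ε₁ * ε₂ * hk - 2 * ε₁ * ε₃ * hf
  · have hf := d.f_eq t (hD ht)
    have hf' := d'.f_eq _ (hD' t ht)
    simp only [Function.comp_apply]
    linear_combination δ₂ ^ 2 * α' t * hf' + ε₁ * hf
  · have hg := d.g_eq t (hD ht)
    have hg' := d'.g_eq _ (hD' t ht)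
    simp only [Function.comp_apply]
    linear_combination α' t * hg' + ε₁ ^ 3 * hg
  · have hk := d.k_eq t (hD ht)
    have hf := d.f_eq t (hD ht)
    refine (((d.shift_hasDerivAt t (hD ht)).const_mul ε₁).add
      ((d'.shift_hasDerivAt _ (hD' t ht)).comp t (d.hasDerivAt t (hD ht)))).congr_deriv ?_
    field_simp
    linear_combination ε₁ * (ε₃ * ε₂ * hk - ε₃ ^ 2 * hf)
  · have := d'.map_eq _ (hm hp)
    rw [Function.comp_apply, this, d.map_eq p hp]
    simp only [Function.comp_apply, Prod.mk.injEq, true_and]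
    constructor <;> ring

theorem exists_inverse (d : InducedData E E' Ω Φ D α α' h δ₁ δ₂ δ₃) (hΩ : IsOpen Ω)
    (hc : IsConnected Ω) : ∃ Ψ : ℝ × ℝ × ℝ → ℝ × ℝ × ℝ, LeftInvOn Ψ Φ Ω ∧
      IsInduced E' E (Φ '' Ω) Ψ := by
  have hδ₁ := d.δ₁_ne_zero
  have hδ₂ := d.δ₂_ne_zero
  obtain ⟨hDo, hDc, β, hβ, hβs, hβd⟩ :=
    exists_smooth_inverse d.isOpen d.isConnected d.smooth d.hasDerivAt d.ne_zero
  set Ψ : ℝ × ℝ × ℝ → ℝ × ℝ × ℝ := fun q =>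
    (β q.1, δ₁⁻¹ * q.2.1 + -(δ₁⁻¹ * h (β q.1)), δ₂⁻¹ * q.2.2 + -(δ₃ / δ₂)) with hΨ
  have hβm : MapsTo β (α '' D) D := by
    rintro _ ⟨t, ht, rfl⟩
    rwa [hβ t ht]
  have hleft : LeftInvOn Ψ Φ Ω := by
    intro p hp
    rw [d.map_eq p hp]
    simp only [hΨ, hβ _ (d.fst_mem p hp)]
    refine Prod.ext rfl (Prod.ext ?_ ?_) <;> simp only <;> field_simp <;> ring
  have hcont : ContinuousOn Ψ (Prod.fst ⁻¹' (α '' D)) := by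
    have hf : ContinuousOn (fun q : ℝ × ℝ × ℝ => β q.1) (Prod.fst ⁻¹' (α '' D)) :=
      hβs.continuousOn.comp continuous_fst.continuousOn fun q hq => hq
    have hh : ContinuousOn (fun q : ℝ × ℝ × ℝ => h (β q.1)) (Prod.fst ⁻¹' (α '' D)) :=
      d.contDiffOn_shift.continuousOn.comp hf fun q hq => hβm hq
    exact hf.prodMk (((continuous_const.mul continuous_snd.fst).continuousOn.add
      (continuousOn_const.mul hh).neg).prodMk (by fun_prop))
  -- This describes the image as a preimage under the continuous map `Ψ`, which makes it open.
  have himage : Φ '' Ω = Prod.fst ⁻¹' (α '' D) ∩ Ψ ⁻¹' Ω := by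
    ext q
    constructor
    · rintro ⟨p, hp, rfl⟩
      refine ⟨?_, ?_⟩
      · rw [mem_preimage, d.map_eq p hp]
        exact ⟨p.1, d.fst_mem p hp, rfl⟩
      · rw [mem_preimage, hleft hp]
        exact hp
    · rintro ⟨⟨t, ht, hqt⟩, hq⟩
      refine ⟨Ψ q, hq, ?_⟩
      rw [d.map_eq _ hq]
      simp only [hΨ, ← hqt, hβ t ht]
      refine Prod.ext hqt (Prod.ext ?_ ?_) <;> simp only <;> field_simp <;> ring
  refine ⟨Ψ, hleft, InducedData.isInduced (D := α '' D) (α := β) (α' := fun τ => (α' (β τ))⁻¹)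
    (h := fun τ => -(δ₁⁻¹ * h (β τ))) (δ₁ := δ₁⁻¹) (δ₂ := δ₂⁻¹) (δ₃ := -(δ₃ / δ₂))
    ⟨hDo, hDc, hβs, ?_, ?_, inv_ne_zero hδ₁, inv_ne_zero hδ₂, ?_, ?_, ?_, ?_, ?_, ?_, ?_,
      fun q _ => rfl⟩ ?_ (hc.image _ d.contDiffOn.continuousOn)⟩
  · rintro _ ⟨t, ht, rfl⟩
    rw [hβ t ht]
    exact hβd t ht
  · rintro _ ⟨t, ht, rfl⟩
    rw [hβ t ht]
    exact inv_ne_zero (d.ne_zero t ht)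
  · rintro _ ⟨t, ht, rfl⟩
    exact d.target_mem t ht
  · rintro _ ⟨t, ht, rfl⟩
    rw [hβ t ht]
    exact d.source_subset ht
  · rintro _ ⟨t, ht, rfl⟩
    have h0 := d.ne_zero t ht
    have hk := d.k_eq t ht
    have hf := d.f_eq t ht
    rw [hβ t ht]
    field_simp
    refine mul_left_cancel₀ hδ₂ ?_
    linear_combination -hk - 2 * δ₃ * hf
  · rintro _ ⟨t, ht, rfl⟩
    have h0 := d.ne_zero t ht
    have hf := d.f_eq t ht
    rw [hβ t ht]
    field_simp
    linear_combination -hf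
  · rintro _ ⟨t, ht, rfl⟩
    have h0 := d.ne_zero t ht
    have hg := d.g_eq t ht
    rw [hβ t ht]
    field_simp
    linear_combination -hg
  · rintro _ ⟨t, ht, rfl⟩
    have h0 := d.ne_zero t ht
    have hk := d.k_eq t ht
    have hf := d.f_eq t ht
    have hh := d.shift_hasDerivAt t ht
    rw [← hβ t ht] at hh
    refine ((hh.comp (α t) (hβd t ht)).const_mul δ₁⁻¹).neg.congr_deriv ?_
    rw [hβ t ht]
    field_simp
    linear_combination δ₃ * hk + δ₃ ^ 2 * hf
  · rintro _ ⟨p, hp, rfl⟩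
    rw [d.map_eq p hp]
    exact ⟨p.1, d.fst_mem p hp, rfl⟩
  · rw [himage]
    exact hcont.isOpen_inter_preimage (hDo.preimage continuous_fst) hΩ

end InducedData

/-! ### Admissible transformations are induced -/

namespace IsAdmissible

variable {E E' : GardnerEq} {Ω : Set (ℝ × ℝ × ℝ)} {T X U : ℝ × ℝ × ℝ → ℝ}

theorem isInduced_aux (h : IsAdmissible E E' Ω fun p => (T p, X p, U p)) :
    IsInduced E E' Ω fun p => (T p, X p, U p) := by
  classical
  have hΩ := h.isPointTransformation.isOpen
  have hc := h.isPointTransformation.isConnected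
  have hT : ContDiffOn ℝ ∞ T Ω := h.isPointTransformation.smooth.fst
  have hX : ContDiffOn ℝ ∞ X Ω := h.isPointTransformation.smooth.snd.fst
  obtain ⟨δ₁, δ₂, δ₃, hδ0, hδ⟩ := h.exists_const
  have hδ₂ := right_ne_zero_of_mul hδ0
  set D : Set ℝ := Prod.fst '' Ω
  have hDo : IsOpen D := isOpenMap_fst Ω hΩ
  have hDc : IsConnected D := hc.image _ continuous_fst.continuousOn
  have hDE : D ⊆ E.dom := by
    rintro _ ⟨p, hp, rfl⟩
    exact h.source_mem p hp
  -- The function `α` takes the common value of `T` on the fibre over `t`; the value 0 off the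
  -- projection of `Ω` is irrelevant.
  obtain ⟨α, hα⟩ : ∃ α : ℝ → ℝ, ∀ p ∈ Ω, T p = α p.1 := by
    refine ⟨fun t => if ht : ∃ q ∈ Ω, q.1 = t then T ht.choose else 0, fun p hp => ?_⟩
    have ht : ∃ q ∈ Ω, q.1 = p.1 := ⟨p, hp, rfl⟩
    simp only [dif_pos ht]
    exact h.fst_eq_of_fst_eq hp ht.choose_spec.1 ht.choose_spec.2.symm
  have hloc : ∀ p ∈ Ω, α =ᶠ[𝓝 p.1] fun s => T (s, p.2.1, p.2.2) := by
    intro p hp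
    have hcont : ContinuousAt (fun s => (s, p.2.1, p.2.2)) p.1 := by fun_prop
    filter_upwards [hcont.eventually_mem (hΩ.mem_nhds hp)] with s hs
    exact (hα _ hs).symm
  have hαd : ∀ p ∈ Ω, HasDerivAt α (∂ₜ T p) p.1 := by
    intro p hp
    have hγ : HasDerivAt (fun s => ((s, p.2.1, p.2.2) : ℝ × ℝ × ℝ)) (1, 0, 0) p.1 :=
      (hasDerivAt_id p.1).prodMk ((hasDerivAt_const _ _).prodMk (hasDerivAt_const _ _))
    have := (hasDerivAt_comp_path hΩ hT hγ hp).congr_of_eventuallyEq (hloc p hp)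
    simpa using this
  have hαs : ContDiffOn ℝ ∞ α D := by
    rintro _ ⟨p, hp, rfl⟩
    have hs : ContDiffAt ℝ ∞ (fun s => T (s, p.2.1, p.2.2)) p.1 :=
      ContDiffAt.comp p.1 (g := T) (f := fun s => (s, p.2.1, p.2.2))
        (hT.contDiffAt (hΩ.mem_nhds hp)) (by fun_prop)
    exact (hs.congr_of_eventuallyEq (hloc p hp)).contDiffWithinAt
  obtain ⟨H, hH⟩ := E.exists_antideriv hDo hDc hDE δ₂ δ₃
  have hf : ∀ p ∈ Ω, E.f p.1 * δ₁ = ∂ₜ T p * E'.f (T p) * δ₂ ^ 2 := by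
    intro p hp
    have := h.f_eq hp
    rwa [(hδ p hp).1, (hδ p hp).2.1] at this
  have hk : ∀ p ∈ Ω, δ₁ * (δ₂ * E.k p.1 - 2 * δ₃ * E.f p.1) =
      ∂ₜ T p * E'.k (T p) * δ₂ ^ 2 := by
    intro p hp
    have h₁ := h.linear_eq hp
    obtain ⟨e₁, e₂, e₃⟩ := hδ p hp
    rw [e₁, e₂, e₃] at h₁
    linear_combination δ₂ * h₁ - (2 * δ₂ * p.2.2 + 2 * δ₃) * hf p hp
  have hXt : ∀ p ∈ Ω, ∂ₜ X p = δ₁ * δ₃ / δ₂ ^ 2 * (δ₂ * E.k p.1 - δ₃ * E.f p.1) := by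
    intro p hp
    have h₁ := (h.affine_eq hp).1
    have h₂ := hk p hp
    obtain ⟨e₁, e₂, e₃⟩ := hδ p hp
    rw [e₁, e₃] at h₁
    field_simp
    -- After substituting `U = δ₂ u + δ₃`, the terms in `u` and `u²` cancel by the relations for `k`
    -- and `f`, which leaves the integrand of the shift.
    linear_combination δ₂ ^ 2 * h₁ - (δ₂ * p.2.2 + δ₃) * h₂ - (δ₂ * p.2.2 + δ₃) ^ 2 * hf p hp
  obtain ⟨δ₄, hδ₄⟩ : ∃ δ₄, ∀ p ∈ Ω, X p - δ₁ * p.2.1 - δ₁ * δ₃ / δ₂ ^ 2 * H p.1 = δ₄ := by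
    have hd : ∀ p ∈ Ω, HasFDerivAt
        (fun p : ℝ × ℝ × ℝ => X p - δ₁ * p.2.1 - δ₁ * δ₃ / δ₂ ^ 2 * H p.1)
        (0 : ℝ × ℝ × ℝ →L[ℝ] ℝ) p := by
      intro p hp
      have h₂ := ((hH p.1 ⟨p, hp, rfl⟩).comp_hasFDerivAt p (hasFDerivAt_fst (𝕜 := ℝ))).const_mul
        (δ₁ * δ₃ / δ₂ ^ 2)
      refine (((hasFDerivAt_of_contDiffOn_isOpen hΩ hX hp).sub
        (hasFDerivAt_snd.fst.const_mul δ₁)).sub h₂).congr_fderiv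
        (ContinuousLinearMap.ext fun w => ?_)
      simp [fderiv_apply_eq_partial, h.partial_snd_eq_zero hp, (hδ p hp).1, hXt p hp]
      ring
    exact exists_eq_of_hasFDerivAt_zero hΩ hc hd
  refine InducedData.isInduced (D := D) (α := α) (α' := deriv α)
    (h := fun t => δ₁ * δ₃ / δ₂ ^ 2 * H t + δ₄) (δ₁ := δ₁) (δ₂ := δ₂) (δ₃ := δ₃)
    ⟨hDo, hDc, hαs, ?_, ?_, left_ne_zero_of_mul hδ0, hδ₂, hDE, ?_, ?_, ?_, ?_,
      fun t ht => ((hH t ht).const_mul _).add_const _, fun p hp => ⟨p, hp, rfl⟩, fun p hp => ?_⟩ hΩ hc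
  · rintro _ ⟨p, hp, rfl⟩
    exact (hαd p hp).differentiableAt.hasDerivAt
  · rintro _ ⟨p, hp, rfl⟩
    rw [(hαd p hp).deriv]
    exact (h.partial_ne_zero hp).1
  · rintro _ ⟨p, hp, rfl⟩
    rw [← hα p hp]
    exact h.target_mem p hp
  · rintro _ ⟨p, hp, rfl⟩
    rw [(hαd p hp).deriv, ← hα p hp]
    linear_combination -hk p hp
  · rintro _ ⟨p, hp, rfl⟩
    rw [(hαd p hp).deriv, ← hα p hp]
    linear_combination -hf p hp
  · rintro _ ⟨p, hp, rfl⟩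
    have hg := h.g_eq hp
    rw [(hδ p hp).1] at hg
    rw [(hαd p hp).deriv, ← hα p hp]
    linear_combination -hg
  · simp only [Prod.mk.injEq]
    exact ⟨hα p hp, by linear_combination hδ₄ p hp, (hδ p hp).2.2⟩

theorem isInduced {Φ : ℝ × ℝ × ℝ → ℝ × ℝ × ℝ} (h : IsAdmissible E E' Ω Φ) : IsInduced E E' Ω Φ :=
  isInduced_aux (T := fun p => (Φ p).1) (X := fun p => (Φ p).2.1) (U := fun p => (Φ p).2.2) h

end IsAdmissible

/-! ### The group acts on the whole class -/

/-- As `α` is a diffeomorphism onto its image, the coefficient formulas can be read as definitions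
at `τ = α t`, using the smooth inverse of `α`. -/
theorem GHat.exists_target (e : GHat) (E : GardnerEq) (hE : e.dom ⊆ E.dom) :
    ∃ E' : GardnerEq, E'.dom = e.α '' e.dom ∧ e.MapsCoeffs E E' := by
  have hδ₁ := left_ne_zero_of_mul e.δ_ne_zero
  have hδ₂ := right_ne_zero_of_mul e.δ_ne_zero
  have hd : ∀ t ∈ e.dom, HasDerivAt e.α (deriv e.α t) t := fun t ht =>
    ((e.smooth_α.contDiffAt (e.isOpen_dom.mem_nhds ht)).differentiableAt (by simp)).hasDerivAt
  obtain ⟨hDo, hDc, β, hβ, hβs, -⟩ :=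
    exists_smooth_inverse e.isOpen_dom e.isConnected_dom e.smooth_α hd e.deriv_α_ne_zero
  have hβm : MapsTo β (e.α '' e.dom) e.dom := by
    rintro _ ⟨t, ht, rfl⟩
    rwa [hβ t ht]
  have hα' : ContDiffOn ℝ ∞ (fun τ => deriv e.α (β τ)) (e.α '' e.dom) :=
    ((contDiffOn_infty_iff_deriv_of_isOpen e.isOpen_dom).1 e.smooth_α).2.comp hβs hβm
  have h0 : ∀ τ ∈ e.α '' e.dom, deriv e.α (β τ) ≠ 0 := fun τ hτ => e.deriv_α_ne_zero _ (hβm hτ)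
  have hk := (E.smooth_k.mono hE).comp hβs hβm
  have hf := (E.smooth_f.mono hE).comp hβs hβm
  have hg := (E.smooth_g.mono hE).comp hβs hβm
  refine ⟨⟨e.α '' e.dom, hDo, hDc,
    fun τ => e.δ₁ / (e.δ₂ * deriv e.α (β τ)) * (E.k (β τ) - 2 * (e.δ₃ / e.δ₂) * E.f (β τ)),
    fun τ => e.δ₁ / (e.δ₂ ^ 2 * deriv e.α (β τ)) * E.f (β τ),
    fun τ => e.δ₁ ^ 3 / deriv e.α (β τ) * E.g (β τ), ?_, ?_, ?_, ?_⟩, rfl,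
    hE, subset_rfl, ?_, ?_, ?_⟩
  · exact (contDiffOn_const.div (contDiffOn_const.mul hα')
      fun τ hτ => mul_ne_zero hδ₂ (h0 τ hτ)).mul (hk.sub (contDiffOn_const.mul hf))
  · exact (contDiffOn_const.div (contDiffOn_const.mul hα')
      fun τ hτ => mul_ne_zero (pow_ne_zero 2 hδ₂) (h0 τ hτ)).mul hf
  · exact (contDiffOn_const.div hα' h0).mul hg
  · intro τ hτ
    have hfg := E.fg_ne_zero _ (hE (hβm hτ))
    have hα0 := h0 τ hτ
    exact mul_ne_zero
      (mul_ne_zero (div_ne_zero hδ₁ (mul_ne_zero (pow_ne_zero 2 hδ₂) hα0))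
        (left_ne_zero_of_mul hfg))
      (mul_ne_zero (div_ne_zero (pow_ne_zero 3 hδ₁) hα0) (right_ne_zero_of_mul hfg))
  all_goals
    intro t ht
    simp only [hβ t ht]

theorem GHat.exists_map (e : GHat) (E : GardnerEq) (hE : e.dom ⊆ E.dom) :
    ∃ Φ : ℝ × ℝ × ℝ → ℝ × ℝ × ℝ, e.MapsVariables E (e.dom ×ˢ univ) Φ := by
  obtain ⟨H, hH⟩ := E.exists_antideriv e.isOpen_dom e.isConnected_dom hE e.δ₂ e.δ₃
  exact ⟨fun p => (e.α p.1, e.δ₁ * p.2.1 + e.δ₁ * e.δ₃ / e.δ₂ ^ 2 * H p.1 + e.δ₄,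
    e.δ₂ * p.2.2 + e.δ₃), H, hH, fun p hp => ⟨hp.1, rfl⟩⟩

theorem GardnerEq.isInduced_id (E : GardnerEq) : IsInduced E E (E.dom ×ˢ univ) id := by
  refine InducedData.isInduced (D := E.dom) (α := fun t => t) (α' := fun _ => 1) (h := fun _ => 0)
    (δ₁ := 1) (δ₂ := 1) (δ₃ := 0) ⟨E.isOpen_dom, E.isConnected_dom, contDiffOn_id,
    fun t _ => hasDerivAt_id t, fun _ _ => one_ne_zero, one_ne_zero, one_ne_zero, subset_rfl,
    fun _ ht => ht, fun t _ => by ring, fun t _ => by ring, fun t _ => by ring, fun t _ => ?_,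
    fun p hp => hp.1, fun p _ => by simp⟩ (E.isOpen_dom.prod isOpen_univ)
    (E.isConnected_dom.prod isConnected_univ)
  simpa using hasDerivAt_const t (0 : ℝ)

/-- The equivalence groupoid of the class of Gardner equations consists exactly of the admissible
transformations induced by the generalized extended equivalence group; the transformations of this
group act on the whole class and are closed under identity, composition and inversion. -/
theorem proposition1 :
    -- the equivalence groupoid is generated by the group
    (∀ (E E' : GardnerEq) (Ω : Set (ℝ × ℝ × ℝ)) (Φ : ℝ × ℝ × ℝ → ℝ × ℝ × ℝ),
      IsAdmissible E E' Ω Φ ↔ IsInduced E E' Ω Φ) ∧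
    -- each element of the group is applicable to each equation of the class
    (∀ (e : GHat) (E : GardnerEq), e.dom ⊆ E.dom →
      ∃ (E' : GardnerEq) (Φ : ℝ × ℝ × ℝ → ℝ × ℝ × ℝ), E'.dom = e.α '' e.dom ∧
        e.MapsCoeffs E E' ∧ e.MapsVariables E (e.dom ×ˢ univ) Φ ∧
        IsAdmissible E E' (e.dom ×ˢ univ) Φ) ∧
    -- identity, composition, inversion
    (∀ E : GardnerEq, IsInduced E E (E.dom ×ˢ univ) id) ∧
    (∀ (E E' E'' : GardnerEq) (Ω Ω' : Set (ℝ × ℝ × ℝ)) (Φ Φ' : ℝ × ℝ × ℝ → ℝ × ℝ × ℝ),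
      IsInduced E E' Ω Φ → IsInduced E' E'' Ω' Φ' → MapsTo Φ Ω Ω' →
        IsInduced E E'' Ω (Φ' ∘ Φ)) ∧
    (∀ (E E' : GardnerEq) (Ω : Set (ℝ × ℝ × ℝ)) (Φ : ℝ × ℝ × ℝ → ℝ × ℝ × ℝ),
      IsInduced E E' Ω Φ →
        ∃ Ψ : ℝ × ℝ × ℝ → ℝ × ℝ × ℝ, LeftInvOn Ψ Φ Ω ∧ IsInduced E' E (Φ '' Ω) Ψ) := by
  refine ⟨fun E E' Ω Φ => ⟨fun h => h.isInduced, fun h => ?_⟩, fun e E hE => ?_,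
    GardnerEq.isInduced_id, fun E E' E'' Ω Ω' Φ Φ' h h' hm => ?_, fun E E' Ω Φ h => ?_⟩
  · obtain ⟨_, _, _, _, _, _, _, d⟩ := h.exists_inducedData
    exact d.isAdmissible h.1 h.2.1
  · obtain ⟨E', hdom, hc⟩ := e.exists_target E hE
    obtain ⟨Φ, hv⟩ := e.exists_map E hE
    obtain ⟨_, d⟩ := GHat.inducedData hc hv
    exact ⟨E', Φ, hdom, hc, hv, d.isAdmissible (e.isOpen_dom.prod isOpen_univ)
      (e.isConnected_dom.prod isConnected_univ)⟩
  · obtain ⟨_, _, _, _, _, _, _, d⟩ := h.exists_inducedData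
    obtain ⟨_, _, _, _, _, _, _, d'⟩ := h'.exists_inducedData
    exact (d.comp d' h.1 h.2.1 hm).isInduced h.1 h.2.1
  · obtain ⟨_, _, _, _, _, _, _, d⟩ := h.exists_inducedData
    exact d.exists_inverse h.1 h.2.1
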